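/- There is a universal constant $C>0$ such that the following holds. Let $G$ be a simple undirected graph on $N=2^n$ vertices in which every vertex has degree at most $d$, let $A$ be its adjacency matrix, let $\gamma\in\mathbb{R}$ and $H=\gamma A$, and identify the vertices of $G$ with the computational basis states of $n$ qubits by any bijection. Write $\|\cdot\|$ for the spectral norm. Then for every positive integer $k$ and all real $t$ and $\epsilon$ with $0<\epsilon\le 1\le 12d\,5^{k-1}\|H\|t$ there is a quantum circuit on the $n$ qubits and at most one ancilla qubit, composed of at most $$C\,\frac{d^{\,3+1/(2k)}\,5^{2k}\,(\|H\|t)^{1+1/(2k)}\,N\log N}{\epsilon^{1/(2k)}}$$ elementary gates (arbitrary single-qubit unitaries and CNOT gates), that implements $e^{-iHt}$ to within error $\epsilon$ in spectral norm: if $\tilde U$ is the unitary of the circuit and $J$ is the isometry that appends the ancilla qubits in the state $|0\rangle$, then $\|\tilde U J-Je^{-iHt}\|\le\epsilon$ (that is, $\|\tilde U-e^{-iHt}\|\le\epsilon$ if there is no ancilla). -/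

import Mathlib

open scoped Matrix.Norms.L2Operator

/-- An elementary gate on a register of qubits labelled by `Q`: an arbitrary unitary on a single
qubit, or a CNOT with control `c` and target `t`. -/
inductive ElementaryGate (Q : Type) : Type where
  | single (q : Q) (U : Matrix.unitaryGroup Bool ℂ) : ElementaryGate Q
  | cnot (c t : Q) (hct : c ≠ t) : ElementaryGate Q

/-- The unitary of an elementary gate, as a matrix in the computational basis, which is indexed by
the bit strings `Q → Bool`. -/
def ElementaryGate.toMatrix {Q : Type} [Fintype Q] [DecidableEq Q] :
    ElementaryGate Q → Matrix (Q → Bool) (Q → Bool) ℂ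
  | .single q U => Matrix.of fun x y => if ∀ j, j ≠ q → x j = y j then U.1 (x q) (y q) else 0
  | .cnot c t _ => Matrix.of fun x y => if x = Function.update y t (xor (y t) (y c)) then 1 else 0

/-- A quantum circuit is a list of elementary gates, applied from left to right; its size (the
number of elementary gates) is the length of the list. -/
abbrev QuantumCircuit (Q : Type) : Type := List (ElementaryGate Q)

/-- The unitary that a circuit performs: for the list `[g₁, …, gᵣ]` it is `gᵣ * ⋯ * g₁`. -/
def QuantumCircuit.toMatrix {Q : Type} [Fintype Q] [DecidableEq Q] :
    QuantumCircuit Q → Matrix (Q → Bool) (Q → Bool) ℂ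
  | [] => 1
  | g :: c => QuantumCircuit.toMatrix c * g.toMatrix

/-- The isometry `|v⟩ ↦ |enc v⟩ |0…0⟩` from `ℂ^V` into the state space of a working register of `n`
qubits together with `a` ancilla qubits; `enc` labels the basis of `ℂ^V` by `n`-bit strings. -/
def ancillaIsometry {V : Type} {n : ℕ} (enc : V ≃ (Fin n → Bool)) (a : ℕ) :
    Matrix (Fin n ⊕ Fin a → Bool) V ℂ :=
  Matrix.of fun z v => if z = Sum.elim (enc v) (fun _ => false) then 1 else 0

/-- A circuit on `n` working and `a` ancilla qubits implements the operator `U` within error `ε` in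
spectral norm: on states whose ancillas start in `|0…0⟩` it agrees up to `ε` with applying `U` and
leaving the ancillas in `|0…0⟩`. Without ancillas this is `‖Ũ - U‖ ≤ ε` for the circuit's unitary
`Ũ`. -/
def QuantumCircuit.Implements {V : Type} [Fintype V] [DecidableEq V] {n a : ℕ}
    (c : QuantumCircuit (Fin n ⊕ Fin a)) (enc : V ≃ (Fin n → Bool)) (U : Matrix V V ℂ) (ε : ℝ) :
    Prop :=
  ‖c.toMatrix * ancillaIsometry enc a - ancillaIsometry enc a * U‖ ≤ ε

/-- The Hamiltonian `H = γ A` of the continuous-time quantum walk on `G`. -/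
noncomputable def walkHamiltonian {V : Type} (G : SimpleGraph V) [DecidableRel G.Adj] (γ : ℝ) :
    Matrix V V ℂ :=
  (γ : ℂ) • G.adjMatrix ℂ

/-- The time-evolution operator `e^{-iHt}`. -/
noncomputable def timeEvolution {V : Type} [Fintype V] [DecidableEq V] (H : Matrix V V ℂ) (t : ℝ) :
    Matrix V V ℂ :=
  NormedSpace.exp ((-(Complex.I * (t : ℂ))) • H)

/-! A greedy edge colouring writes `H` as `γ` times a sum of `2d + 1` matchings. Suzuki's product
formula of order `2k` reduces `e^{-iHt}` to exponentials of matchings, and each of these is a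
product of commuting two-level rotations, one per edge.

Error: the order of the formula is found in formal power series with noncommuting coefficients,
where time symmetry kills the even error terms and `suzukiCoeff` the odd ones
(`suzukiFormula_order`). One step and the exact exponential both have coefficients dominated by
those of `exp (Λ X)` and agree below degree `2k + 1`, so they differ by at most `6 Λ^(2k+1)` once `Λ
≤ 1`. All factors have norm at most one, so the errors of `r` steps at most add up
(`norm_suzuki_pow_sub_exp_le`). Matchings have norm at most one and `|γ| ≤ ‖H‖`, which bounds `Λ`.

Gates: CNOTs, NOTs and a Hadamard gate conjugate a two-level rotation to a phase on one qubit
controlled by all others. Multiply controlled flips need linearly many gates given one borrowed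
qubit, the ancilla, so a rotation costs at most `320 n` gates, exactly
(`hasExactCircuit_exp_edgeMatrix`). There are at most `N d / 2` edges, each visited `2 * 5^(k-1)`
times per step; the choice of `r` finishes the count, with a factor `d` to spare. -/

/-! ### Exponentials as formal power series. -/

section FormalExponential

open PowerSeries

variable {R : Type*} [Ring R] [Algebra ℂ R]

/-- The formal power series `∑ Bʲ Xʲ / j!`. -/
noncomputable def formalExp (B : R) : R⟦X⟧ :=
  PowerSeries.mk fun j => ((j.factorial : ℂ)⁻¹) • B ^ j

theorem coeff_formalExp (B : R) (j : ℕ) :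
    coeff j (formalExp B) = ((j.factorial : ℂ)⁻¹) • B ^ j := coeff_mk _ _

theorem constantCoeff_formalExp (B : R) : constantCoeff (formalExp B) = 1 := by
  rw [← coeff_zero_eq_constantCoeff_apply, coeff_formalExp]; simp

theorem formalExp_zero : formalExp (0 : R) = 1 := by
  ext j
  rw [coeff_formalExp, coeff_one]
  split_ifs with h
  · simp [h]
  · simp [h]

theorem formalExp_mul_of_commute {A B : R} (h : Commute A B) :
    formalExp A * formalExp B = formalExp (A + B) := by
  ext j
  rw [coeff_mul, coeff_formalExp, h.add_pow', Finset.smul_sum]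
  refine Finset.sum_congr rfl fun x hx => ?_
  rw [coeff_formalExp, coeff_formalExp, smul_mul_smul_comm, ← Nat.cast_smul_eq_nsmul ℂ, smul_smul]
  congr 1
  rw [Finset.HasAntidiagonal.mem_antidiagonal] at hx
  subst hx
  rw [Nat.cast_add_choose]
  have h0 : (((x.1 + x.2).factorial : ℕ) : ℂ) ≠ 0 := by exact_mod_cast (Nat.factorial_ne_zero _)
  field_simp

theorem formalExp_smul_mul (H : R) (a b : ℂ) :
    formalExp (a • H) * formalExp (b • H) = formalExp ((a + b) • H) := by
  rw [formalExp_mul_of_commute (((Commute.refl H).smul_left a).smul_right b), add_smul]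

theorem coeff_formalExp_smul (c : ℂ) (B : R) (j : ℕ) :
    coeff j (formalExp (c • B)) = c ^ j • coeff j (formalExp B) := by
  rw [coeff_formalExp, coeff_formalExp, smul_pow, smul_comm]

end FormalExponential

/-! ### Leading error terms of formal series. -/

section LeadingError

open PowerSeries

variable {R : Type*} [Ring R]

/-- `f` agrees with `e` below degree `m`, and exceeds it by `δ` in degree `m`. -/
def HasLeadingError (m : ℕ) (f e : R⟦X⟧) (δ : R) : Prop :=
  ∃ g : R⟦X⟧, f = e + g * X ^ m ∧ constantCoeff g = δ

theorem HasLeadingError.coeff_lt {m : ℕ} {f e : R⟦X⟧} {δ : R} (h : HasLeadingError m f e δ)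
    {j : ℕ} (hj : j < m) : coeff j f = coeff j e := by
  obtain ⟨g, rfl, -⟩ := h
  rw [map_add, PowerSeries.coeff_mul_X_pow', if_neg (by omega), add_zero]

theorem HasLeadingError.coeff_self {m : ℕ} {f e : R⟦X⟧} {δ : R} (h : HasLeadingError m f e δ) :
    coeff m f = coeff m e + δ := by
  obtain ⟨g, rfl, rfl⟩ := h
  rw [map_add, PowerSeries.coeff_mul_X_pow', if_pos le_rfl, Nat.sub_self,
    coeff_zero_eq_constantCoeff_apply]

theorem hasLeadingError_of_coeff {m : ℕ} {f e : R⟦X⟧} {δ : R}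
    (h : ∀ j < m, coeff j f = coeff j e) (hm : coeff m f = coeff m e + δ) :
    HasLeadingError m f e δ := by
  refine ⟨PowerSeries.mk fun i => coeff (i + m) (f - e), ?_, ?_⟩
  · ext j
    rw [map_add, PowerSeries.coeff_mul_X_pow']
    split_ifs with hj
    · rw [coeff_mk, Nat.sub_add_cancel hj, map_sub]; abel
    · rw [h j (by omega), add_zero]
  · rw [constantCoeff_mk, zero_add, map_sub, hm]; abel

/-- Leading errors add under multiplication, even without commutativity: in degree `m` each error
meets only the constant coefficient 1 of the other factor. -/
theorem HasLeadingError.mul {m : ℕ} (hm : 0 < m) {f e f' e' : R⟦X⟧} {δ δ' : R}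
    (h : HasLeadingError m f e δ) (h' : HasLeadingError m f' e' δ')
    (he : constantCoeff e = 1) (he' : constantCoeff e' = 1) :
    HasLeadingError m (f * f') (e * e') (δ + δ') := by
  obtain ⟨g, rfl, rfl⟩ := h
  obtain ⟨g', rfl, rfl⟩ := h'
  refine ⟨g * e' + e * g' + g * g' * X ^ m, ?_, ?_⟩
  · have h1 : g * X ^ m * e' = g * e' * X ^ m := by
      rw [mul_assoc, X_pow_mul, mul_assoc]
    have h2 : g * X ^ m * (g' * X ^ m) = g * g' * X ^ m * X ^ m := by
      rw [← mul_assoc, mul_assoc g, X_pow_mul, ← mul_assoc]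
    rw [add_mul, mul_add, mul_add, h1, h2, add_mul, add_mul, ← mul_assoc]
    abel
  · simp [he, he', hm.ne']

end LeadingError

/-! ### Suzuki's product formulas and their order. -/

section ProductFormula

open PowerSeries

/-- The symmetric (Strang) splitting of a step of length `c` over the terms listed in `js`: a list
of pairs of a time and the label of the term evolved for that time. -/
noncomputable def strangFormula {ι : Type*} (js : List ι) (c : ℝ) : List (ℝ × ι) :=
  js.map (fun i => (c / 2, i)) ++ js.reverse.map (fun i => (c / 2, i))

/-- Suzuki's coefficient `1 / (4 - 4 ^ (1 / m))` that cancels an error term of odd order `m`. -/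
noncomputable def suzukiCoeff (m : ℕ) : ℝ := (4 - (4 : ℝ) ^ ((m : ℝ)⁻¹))⁻¹

/-- Suzuki's recursive product formula; index `k` gives a formula of order `2 * k + 2`. -/
noncomputable def suzukiFormula {ι : Type*} (js : List ι) : ℕ → ℝ → List (ℝ × ι)
  | 0, c => strangFormula js c
  | k + 1, c =>
    suzukiFormula js k (suzukiCoeff (2 * k + 3) * c) ++
    (suzukiFormula js k (suzukiCoeff (2 * k + 3) * c) ++
    (suzukiFormula js k ((1 - 4 * suzukiCoeff (2 * k + 3)) * c) ++
    (suzukiFormula js k (suzukiCoeff (2 * k + 3) * c) ++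
    suzukiFormula js k (suzukiCoeff (2 * k + 3) * c))))

theorem four_rpow_inv_bounds {m : ℕ} (hm : 2 ≤ m) :
    1 ≤ (4 : ℝ) ^ ((m : ℝ)⁻¹) ∧ (4 : ℝ) ^ ((m : ℝ)⁻¹) ≤ 2 := by
  have hm' : (2 : ℝ) ≤ m := by exact_mod_cast hm
  constructor
  · exact Real.one_le_rpow (by norm_num) (by positivity)
  · calc (4 : ℝ) ^ ((m : ℝ)⁻¹) ≤ (4 : ℝ) ^ ((2 : ℝ)⁻¹) :=
          Real.rpow_le_rpow_of_exponent_le (by norm_num)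
            (inv_anti₀ (by norm_num) hm')
      _ = 2 := by
          rw [show (4 : ℝ) = 2 ^ (2 : ℝ) by norm_num, ← Real.rpow_mul (by norm_num)]; norm_num

theorem abs_suzukiCoeff_le {m : ℕ} (hm : 2 ≤ m) :
    |suzukiCoeff m| ≤ 1 ∧ |1 - 4 * suzukiCoeff m| ≤ 1 := by
  obtain ⟨h1, h2⟩ := four_rpow_inv_bounds hm
  unfold suzukiCoeff
  set x := (4 : ℝ) ^ ((m : ℝ)⁻¹)
  have h3 : (0 : ℝ) < 4 - x := by linarith
  have h5 : (4 - x)⁻¹ ≤ 2⁻¹ := inv_anti₀ (by norm_num) (by linarith)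
  have h6 : 0 < (4 - x)⁻¹ := by positivity
  constructor <;> rw [abs_le] <;> constructor <;> linarith

/-- With `x = 4^(1/m)` and `p = 1/(4 - x)` one has `1 - 4p = -xp`, whose odd power `m` is `-4 p^m`.
-/
theorem suzukiCoeff_cancel {m : ℕ} (hm : 2 ≤ m) (hodd : Odd m) :
    4 * suzukiCoeff m ^ m + (1 - 4 * suzukiCoeff m) ^ m = 0 := by
  obtain ⟨h1, h2⟩ := four_rpow_inv_bounds hm
  have hx : ((4 : ℝ) ^ ((m : ℝ)⁻¹)) ^ m = 4 :=
    Real.rpow_inv_natCast_pow (by norm_num) (by omega)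
  unfold suzukiCoeff
  set x := (4 : ℝ) ^ ((m : ℝ)⁻¹)
  have h3 : (4 : ℝ) - x ≠ 0 := by linarith
  have h4 : 1 - 4 * (4 - x)⁻¹ = -(x * (4 - x)⁻¹) := by field_simp; ring
  rw [h4, hodd.neg_pow, mul_pow, hx]; ring

variable {ι R : Type*} [Ring R] [Algebra ℂ R]

/-- The formal power series of a product formula for the terms `B i`. -/
noncomputable def formalProduct (B : ι → R) (l : List (ℝ × ι)) : R⟦X⟧ :=
  (l.map fun a => formalExp ((a.1 : ℂ) • B a.2)).prod

theorem formalProduct_nil (B : ι → R) : formalProduct B [] = 1 := rfl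

theorem formalProduct_cons (B : ι → R) (a : ℝ × ι) (l : List (ℝ × ι)) :
    formalProduct B (a :: l) = formalExp ((a.1 : ℂ) • B a.2) * formalProduct B l := by
  simp [formalProduct]

theorem formalProduct_append (B : ι → R) (l l' : List (ℝ × ι)) :
    formalProduct B (l ++ l') = formalProduct B l * formalProduct B l' := by
  simp [formalProduct]

theorem constantCoeff_formalProduct (B : ι → R) (l : List (ℝ × ι)) :
    constantCoeff (formalProduct B l) = 1 := by
  induction l with
  | nil => simp [formalProduct_nil]
  | cons a l ih => rw [formalProduct_cons, map_mul, ih, constantCoeff_formalExp, one_mul]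

theorem coeff_formalProduct_map_mul (B : ι → R) (l : List (ℝ × ι)) (c : ℝ) (j : ℕ) :
    coeff j (formalProduct B (l.map fun a => (c * a.1, a.2))) =
      (c : ℂ) ^ j • coeff j (formalProduct B l) := by
  induction l generalizing j with
  | nil =>
    simp only [List.map_nil, formalProduct_nil, coeff_one]
    split_ifs with h <;> simp [h]
  | cons a l ih =>
    rw [List.map_cons, formalProduct_cons, formalProduct_cons, coeff_mul, coeff_mul,
      Finset.smul_sum]
    refine Finset.sum_congr rfl fun x hx => ?_
    rw [Finset.HasAntidiagonal.mem_antidiagonal] at hx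
    rw [ih, Complex.ofReal_mul, mul_smul, coeff_formalExp_smul, smul_mul_smul_comm, ← pow_add, hx]

theorem formalProduct_mul_reverse_neg (B : ι → R) (l : List (ℝ × ι)) :
    formalProduct B l * formalProduct B (l.reverse.map fun a => (-1 * a.1, a.2)) = 1 := by
  induction l with
  | nil => simp [formalProduct_nil]
  | cons a l ih =>
    rw [List.reverse_cons, List.map_append, formalProduct_append, formalProduct_cons,
      ← mul_assoc, mul_assoc (formalExp _), ih, mul_one, List.map_singleton, formalProduct_cons,
      formalProduct_nil, mul_one, formalExp_smul_mul]
    simp [formalExp_zero]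

theorem suzukiFormula_map_mul (js : List ι) (k : ℕ) (s c : ℝ) :
    (suzukiFormula js k c).map (fun a => (s * a.1, a.2)) = suzukiFormula js k (s * c) := by
  induction k generalizing c with
  | zero => simp [suzukiFormula, strangFormula, Function.comp_def, mul_div_assoc]
  | succ k ih => simp only [suzukiFormula, List.map_append, ih, mul_left_comm s]

theorem suzukiFormula_reverse (js : List ι) (k : ℕ) (c : ℝ) :
    (suzukiFormula js k c).reverse = suzukiFormula js k c := by
  induction k generalizing c with
  | zero => simp [suzukiFormula, strangFormula]
  | succ k ih => simp only [suzukiFormula, List.reverse_append, ih, List.append_assoc]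

/-- Time symmetry: the list is a palindrome, so running it with negated times undoes it factor by
factor. -/
theorem formalProduct_suzukiFormula_mul_neg (B : ι → R) (js : List ι) (k : ℕ) (c : ℝ) :
    formalProduct B (suzukiFormula js k c) * formalProduct B (suzukiFormula js k (-c)) = 1 := by
  have h := formalProduct_mul_reverse_neg B (suzukiFormula js k c)
  rwa [suzukiFormula_reverse, suzukiFormula_map_mul, neg_one_mul] at h

theorem coeff_formalProduct_suzukiFormula (B : ι → R) (js : List ι) (k : ℕ) (c : ℝ) (j : ℕ) :
    coeff j (formalProduct B (suzukiFormula js k c)) =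
      (c : ℂ) ^ j • coeff j (formalProduct B (suzukiFormula js k 1)) := by
  rw [← coeff_formalProduct_map_mul, suzukiFormula_map_mul, mul_one]

/-- The first error term of a Suzuki formula scales like a power of the step length. -/
theorem hasLeadingError_suzukiFormula (B : ι → R) (js : List ι) (k m : ℕ) (H : R)
    (h : ∀ j < m, coeff j (formalProduct B (suzukiFormula js k 1)) = coeff j (formalExp H)) :
    ∃ D : R, ∀ c : ℝ, HasLeadingError m (formalProduct B (suzukiFormula js k c))
      (formalExp ((c : ℂ) • H)) ((c : ℂ) ^ m • D) := by
  refine ⟨coeff m (formalProduct B (suzukiFormula js k 1)) - coeff m (formalExp H), fun c => ?_⟩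
  refine hasLeadingError_of_coeff (fun j hj => ?_) ?_
  · rw [coeff_formalProduct_suzukiFormula, coeff_formalExp_smul, h j hj]
  · rw [coeff_formalProduct_suzukiFormula, coeff_formalExp_smul, ← smul_add]
    congr 1; abel

/-- An even leading error `c^m D` is the same for `c` and `-c`; the product of the two formulas is 1
and so has no error, whence `2 D = 0`. -/
theorem suzukiFormula_even_order (B : ι → R) (js : List ι) (k m : ℕ) (hm : 0 < m) (he : Even m)
    (H : R)
    (h : ∀ j < m, coeff j (formalProduct B (suzukiFormula js k 1)) = coeff j (formalExp H)) :
    ∀ j < m + 1, coeff j (formalProduct B (suzukiFormula js k 1)) = coeff j (formalExp H) := by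
  obtain ⟨D, hD⟩ := hasLeadingError_suzukiFormula B js k m H h
  have h1 := (hD 1).mul hm (hD (-1)) (constantCoeff_formalExp _) (constantCoeff_formalExp _)
  rw [formalProduct_suzukiFormula_mul_neg, formalExp_smul_mul] at h1
  have h2 := h1.coeff_self
  simp only [Complex.ofReal_one, Complex.ofReal_neg, add_neg_cancel, zero_smul, formalExp_zero,
    one_pow, he.neg_one_pow, one_smul, left_eq_add] at h2
  have hD0 : D = 0 := by
    have h3 : (2 : ℂ) • D = 0 := by rw [two_smul]; exact h2
    simpa using congrArg (fun x => (2 : ℂ)⁻¹ • x) h3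
  intro j hj
  rcases Nat.lt_succ_iff_lt_or_eq.mp hj with hj | rfl
  · exact h j hj
  · simpa [hD0] using (hD 1).coeff_self

theorem coeff_one_formalProduct_map (B : ι → R) (c : ℝ) (js : List ι) :
    coeff 1 (formalProduct B (js.map fun i => (c, i))) = (c : ℂ) • (js.map B).sum := by
  induction js with
  | nil => simp [formalProduct_nil, coeff_one]
  | cons i js ih =>
    have hanti : Finset.HasAntidiagonal.antidiagonal 1 = {((0 : ℕ), (1 : ℕ)), (1, 0)} := rfl
    rw [List.map_cons, formalProduct_cons, coeff_mul, hanti, Finset.sum_pair (by simp), ih]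
    simp only [coeff_formalExp, coeff_zero_eq_constantCoeff_apply, constantCoeff_formalProduct,
      List.map_cons, List.sum_cons, smul_add]
    simp [add_comm]

theorem strangFormula_order (B : ι → R) (js : List ι) :
    ∀ j < 2, coeff j (formalProduct B (suzukiFormula js 0 1)) =
      coeff j (formalExp (js.map B).sum) := by
  intro j hj
  interval_cases j
  · simp [coeff_zero_eq_constantCoeff_apply, constantCoeff_formalProduct, constantCoeff_formalExp]
  · have hanti : Finset.HasAntidiagonal.antidiagonal 1 = {((0 : ℕ), (1 : ℕ)), (1, 0)} := rfl
    rw [suzukiFormula, strangFormula, formalProduct_append, coeff_mul, hanti,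
      Finset.sum_pair (by simp), coeff_one_formalProduct_map, coeff_one_formalProduct_map,
      List.map_reverse, List.sum_reverse]
    simp only [coeff_zero_eq_constantCoeff_apply, constantCoeff_formalProduct, one_mul, mul_one,
      coeff_formalExp, ← add_smul]
    norm_num

/-- A Suzuki formula of index `k` is correct to order `2 * k + 2`. -/
theorem suzukiFormula_order (B : ι → R) (js : List ι) (k : ℕ) :
    ∀ j < 2 * k + 3, coeff j (formalProduct B (suzukiFormula js k 1)) =
      coeff j (formalExp (js.map B).sum) := by
  induction k with
  | zero =>
    exact suzukiFormula_even_order B js 0 2 (by norm_num) (by decide) _ (strangFormula_order B js)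
  | succ k ih =>
    obtain ⟨D, hD⟩ := hasLeadingError_suzukiFormula B js k (2 * k + 3) _ ih
    -- Only the odd degree `2k + 3` has to be cancelled by hand; the even degree `2k + 4` then comes
    -- from symmetry.
    refine suzukiFormula_even_order B js (k + 1) (2 * k + 4) (by omega) ⟨k + 2, by ring⟩ _ ?_
    have hm : 0 < 2 * k + 3 := by omega
    set p := suzukiCoeff (2 * k + 3) with hp
    have hc : ∀ c : ℝ, constantCoeff (formalExp ((c : ℂ) • (js.map B).sum)) = 1 :=
      fun c => constantCoeff_formalExp _
    have h1 := hD p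
    have h2 := hD (1 - 4 * p)
    have h3 := h1.mul hm h1 (hc _) (hc _)
    rw [formalExp_smul_mul, ← Complex.ofReal_add] at h3
    have h4 := h2.mul hm h3 (hc _) (hc _)
    rw [formalExp_smul_mul, ← Complex.ofReal_add] at h4
    have h5 := h1.mul hm h4 (hc _) (hc _)
    rw [formalExp_smul_mul, ← Complex.ofReal_add] at h5
    have h6 := h1.mul hm h5 (hc _) (hc _)
    rw [formalExp_smul_mul, ← Complex.ofReal_add] at h6
    simp only [← add_smul] at h6
    have e1 : p + (p + (1 - 4 * p + (p + p))) = 1 := by ring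
    have e2 : (p : ℂ) ^ (2 * k + 3) + ((p : ℂ) ^ (2 * k + 3) + (((1 - 4 * p : ℝ) : ℂ) ^ (2 * k + 3)
        + ((p : ℂ) ^ (2 * k + 3) + (p : ℂ) ^ (2 * k + 3)))) = 0 := by
      have := suzukiCoeff_cancel (m := 2 * k + 3) (by omega) ⟨k + 1, by ring⟩
      rw [← hp] at this
      have h' := congrArg (fun x : ℝ => (x : ℂ)) this
      push_cast at h' ⊢
      linear_combination h'
    rw [e1, e2] at h6
    have e3 : formalProduct B (suzukiFormula js (k + 1) 1) =
        formalProduct B (suzukiFormula js k p) * (formalProduct B (suzukiFormula js k p) *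
          (formalProduct B (suzukiFormula js k (1 - 4 * p)) *
          (formalProduct B (suzukiFormula js k p) * formalProduct B (suzukiFormula js k p)))) := by
      simp only [suzukiFormula, formalProduct_append, mul_one, ← hp]
    rw [← e3, Complex.ofReal_one, one_smul, zero_smul] at h6
    intro j hj
    rcases Nat.lt_succ_iff_lt_or_eq.mp hj with hj | rfl
    · exact h6.coeff_lt hj
    · simpa using h6.coeff_self

end ProductFormula

/-! ### Majorants that turn formal agreement into norm bounds. -/

section Majorant

open PowerSeries

variable {𝔸 : Type*} [NormedRing 𝔸]

/-- The power series `f` sums to `x` at `1`, with coefficients bounded by those of `exp (Λ X)`. -/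
def HasMajorant (f : 𝔸⟦X⟧) (x : 𝔸) (Λ : ℝ) : Prop :=
  (∀ j, ‖coeff j f‖ ≤ Λ ^ j / j.factorial) ∧ HasSum (fun j => coeff j f) x

theorem HasMajorant.mono {f : 𝔸⟦X⟧} {x : 𝔸} {Λ Λ' : ℝ} (h : HasMajorant f x Λ) (h0 : 0 ≤ Λ)
    (hΛ : Λ ≤ Λ') : HasMajorant f x Λ' :=
  ⟨fun j => (h.1 j).trans (by gcongr), h.2⟩

theorem HasMajorant.summable_norm {f : 𝔸⟦X⟧} {x : 𝔸} {Λ : ℝ} (h : HasMajorant f x Λ) :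
    Summable fun j => ‖coeff j f‖ :=
  Summable.of_nonneg_of_le (fun _ => norm_nonneg _) h.1 (Real.summable_pow_div_factorial Λ)

/-- The Cauchy product of the two exponential bounds is the binomial expansion of `(Λ + Λ')^j / j!`.
-/
theorem HasMajorant.mul [CompleteSpace 𝔸] {f g : 𝔸⟦X⟧} {x y : 𝔸} {Λ Λ' : ℝ}
    (h : HasMajorant f x Λ) (h' : HasMajorant g y Λ') (h0 : 0 ≤ Λ) :
    HasMajorant (f * g) (x * y) (Λ + Λ') := by
  constructor
  · intro j
    rw [coeff_mul, (Commute.all Λ Λ').add_pow', Finset.sum_div]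
    refine (norm_sum_le _ _).trans (Finset.sum_le_sum fun a ha => ?_)
    rw [Finset.HasAntidiagonal.mem_antidiagonal] at ha
    subst ha
    calc ‖coeff a.1 f * coeff a.2 g‖ ≤ ‖coeff a.1 f‖ * ‖coeff a.2 g‖ := norm_mul_le _ _
      _ ≤ (Λ ^ a.1 / a.1.factorial) * (Λ' ^ a.2 / a.2.factorial) :=
          mul_le_mul (h.1 _) (h'.1 _) (norm_nonneg _) (by positivity)
      _ = _ := by
          rw [nsmul_eq_mul, Nat.cast_add_choose]
          have h0 : (((a.1 + a.2).factorial : ℕ) : ℝ) ≠ 0 := by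
            exact_mod_cast (Nat.factorial_ne_zero _)
          field_simp
  · rw [← h.2.tsum_eq, ← h'.2.tsum_eq,
      tsum_mul_tsum_eq_tsum_sum_antidiagonal_of_summable_norm h.summable_norm h'.summable_norm]
    simp only [coeff_mul]
    exact (summable_norm_sum_mul_antidiagonal_of_summable_norm h.summable_norm
      h'.summable_norm).of_norm.hasSum

/-- Only degrees `j ≥ m` contribute, each at most `2 Λ^j / j! ≤ 2 Λ^m / j!` as `Λ ≤ 1`; the sum is
at most `2e Λ^m`, and `2e < 6`. -/
theorem HasMajorant.norm_sub_le {f g : 𝔸⟦X⟧} {x y : 𝔸} {Λ : ℝ} {m : ℕ}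
    (h : HasMajorant f x Λ) (h' : HasMajorant g y Λ) (h0 : 0 ≤ Λ) (h1 : Λ ≤ 1)
    (hm : ∀ j < m, coeff j f = coeff j g) : ‖x - y‖ ≤ 6 * Λ ^ m := by
  have hexp : HasSum (fun j : ℕ => 2 * Λ ^ m * ((1 : ℝ) ^ j / (j.factorial : ℝ)))
      (2 * Λ ^ m * Real.exp 1) := by
    rw [Real.exp_eq_exp_ℝ]
    exact (NormedSpace.expSeries_div_hasSum_exp (1 : ℝ)).mul_left _
  have hsub := h.2.sub h'.2
  have hle : ‖x - y‖ ≤ 2 * Λ ^ m * Real.exp 1 := by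
    rw [← hsub.tsum_eq]
    refine tsum_of_norm_bounded hexp fun j => ?_
    by_cases hj : j < m
    · rw [hm j hj, sub_self, norm_zero]; positivity
    · calc ‖coeff j f - coeff j g‖ ≤ ‖coeff j f‖ + ‖coeff j g‖ := _root_.norm_sub_le _ _
        _ ≤ Λ ^ j / j.factorial + Λ ^ j / j.factorial := add_le_add (h.1 j) (h'.1 j)
        _ = 2 * Λ ^ j * (1 ^ j / j.factorial) := by rw [one_pow]; ring
        _ ≤ _ := by
          have := pow_le_pow_of_le_one h0 h1 (not_lt.mp hj)
          gcongr
  have he := Real.exp_one_lt_d9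
  have hp : 0 ≤ Λ ^ m := by positivity
  nlinarith

theorem norm_pow_sub_pow_le {x y : 𝔸} (hx : ‖x‖ ≤ 1) (hy : ‖y‖ ≤ 1) [NormOneClass 𝔸] (r : ℕ) :
    ‖x ^ r - y ^ r‖ ≤ r * ‖x - y‖ := by
  induction r with
  | zero => simp
  | succ r ih =>
    have hyr : ‖y ^ r‖ ≤ 1 := (norm_pow_le y r).trans (pow_le_one₀ (norm_nonneg _) hy)
    have e : x ^ (r + 1) - y ^ (r + 1) = (x ^ r - y ^ r) * x + y ^ r * (x - y) := by
      rw [pow_succ, pow_succ, sub_mul, mul_sub]; abel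
    rw [e]
    calc _ ≤ ‖x ^ r - y ^ r‖ * ‖x‖ + ‖y ^ r‖ * ‖x - y‖ :=
          (norm_add_le _ _).trans (add_le_add (norm_mul_le _ _) (norm_mul_le _ _))
      _ ≤ (r * ‖x - y‖) * 1 + 1 * ‖x - y‖ := by gcongr
      _ = _ := by push_cast; ring

end Majorant

/-! ### Error of a product formula in norm. -/

section ProductFormulaError

open PowerSeries

variable {ι 𝔸 : Type*} [NormedRing 𝔸]

/-- The total evolution time of a product formula, weighted by the norms of the terms. -/
noncomputable def formulaWeight (B : ι → 𝔸) (l : List (ℝ × ι)) : ℝ :=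
  (l.map fun a => |a.1| * ‖B a.2‖).sum

theorem formulaWeight_append (B : ι → 𝔸) (l l' : List (ℝ × ι)) :
    formulaWeight B (l ++ l') = formulaWeight B l + formulaWeight B l' := by
  simp [formulaWeight]

theorem formulaWeight_nonneg (B : ι → 𝔸) (l : List (ℝ × ι)) : 0 ≤ formulaWeight B l :=
  List.sum_nonneg fun x hx => by
    obtain ⟨a, -, rfl⟩ := List.mem_map.mp hx
    positivity

/-- Both Suzuki multipliers have absolute value at most 1, so each of the five copies weighs no more
than the bound for the previous index. -/
theorem formulaWeight_suzukiFormula_le (B : ι → 𝔸) (js : List ι) (k : ℕ) (c : ℝ) :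
    formulaWeight B (suzukiFormula js k c) ≤ 5 ^ k * |c| * (js.map fun i => ‖B i‖).sum := by
  have hB : 0 ≤ (js.map fun i => ‖B i‖).sum := List.sum_nonneg fun x hx => by
    obtain ⟨a, -, rfl⟩ := List.mem_map.mp hx
    positivity
  induction k generalizing c with
  | zero =>
    rw [suzukiFormula, strangFormula, formulaWeight_append]
    simp only [formulaWeight, List.map_map, Function.comp_def, List.map_reverse, List.sum_reverse,
      List.sum_map_mul_left, abs_div, abs_two]
    exact le_of_eq (by ring)
  | succ k ih =>
    obtain ⟨h1, h2⟩ := abs_suzukiCoeff_le (m := 2 * k + 3) (by omega)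
    simp only [suzukiFormula, formulaWeight_append]
    set p := suzukiCoeff (2 * k + 3)
    have hp : ∀ q : ℝ, |q| ≤ 1 → formulaWeight B (suzukiFormula js k (q * c)) ≤
        5 ^ k * |c| * (js.map fun i => ‖B i‖).sum := fun q hq => by
      refine (ih _).trans ?_
      rw [abs_mul]
      gcongr
      exact mul_le_of_le_one_left (abs_nonneg _) hq
    have := hp p h1
    have := hp _ h2
    rw [pow_succ]
    linarith

variable [NormedAlgebra ℂ 𝔸]

/-- The product of exponentials described by a product formula for the terms `B i`. -/
noncomputable def expProduct (B : ι → 𝔸) (l : List (ℝ × ι)) : 𝔸 :=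
  (l.map fun a => NormedSpace.exp ((a.1 : ℂ) • B a.2)).prod

theorem norm_expProduct_le_one [NormOneClass 𝔸] (B : ι → 𝔸)
    (hB : ∀ i (s : ℝ), ‖NormedSpace.exp ((s : ℂ) • B i)‖ ≤ 1) (l : List (ℝ × ι)) :
    ‖expProduct B l‖ ≤ 1 := by
  induction l with
  | nil => simp [expProduct]
  | cons a l ih =>
    simp only [expProduct, List.map_cons, List.prod_cons] at ih ⊢
    exact (norm_mul_le _ _).trans (mul_le_one₀ (hB _ _) (norm_nonneg _) ih)

variable [CompleteSpace 𝔸] [NormOneClass 𝔸]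

theorem hasMajorant_formalExp (B : 𝔸) : HasMajorant (formalExp B) (NormedSpace.exp B) ‖B‖ := by
  constructor
  · intro j
    rw [coeff_formalExp, norm_smul, norm_inv, Complex.norm_natCast, div_eq_inv_mul]
    gcongr
    exact norm_pow_le _ _
  · simp only [coeff_formalExp]
    exact NormedSpace.exp_series_hasSum_exp' B

theorem hasMajorant_formalProduct (B : ι → 𝔸) (l : List (ℝ × ι)) :
    HasMajorant (formalProduct B l) (expProduct B l) (formulaWeight B l) := by
  induction l with
  | nil =>
    have := hasMajorant_formalExp (0 : 𝔸)
    rw [formalExp_zero, NormedSpace.exp_zero, norm_zero] at this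
    simpa [formalProduct, expProduct, formulaWeight] using this
  | cons a l ih =>
    have := (hasMajorant_formalExp ((a.1 : ℂ) • B a.2)).mul ih (norm_nonneg _)
    rw [norm_smul, Complex.norm_real, Real.norm_eq_abs] at this
    simpa [formalProduct, expProduct, formulaWeight] using this

/-- The error of `r` equal steps of a Suzuki formula. -/
theorem norm_suzuki_pow_sub_exp_le (B : ι → 𝔸) (js : List ι) (k r : ℕ) (hr : 0 < r) (Λ : ℝ)
    (hΛ : 5 ^ k * (js.map fun i => ‖B i‖).sum ≤ Λ) (hΛr : Λ / r ≤ 1)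
    (hB : ∀ i (s : ℝ), ‖NormedSpace.exp ((s : ℂ) • B i)‖ ≤ 1)
    (hH : ∀ s : ℝ, ‖NormedSpace.exp ((s : ℂ) • (js.map B).sum)‖ ≤ 1) :
    ‖expProduct B (suzukiFormula js k (1 / r)) ^ r - NormedSpace.exp (js.map B).sum‖ ≤
      r * (6 * (Λ / r) ^ (2 * k + 3)) := by
  have hr' : (0 : ℝ) < r := by exact_mod_cast hr
  have hB0 : 0 ≤ (js.map fun i => ‖B i‖).sum := List.sum_nonneg fun x hx => by
    obtain ⟨a, -, rfl⟩ := List.mem_map.mp hx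
    positivity
  have hΛ0 : 0 ≤ Λ := le_trans (by positivity) hΛ
  have hexp : NormedSpace.exp (js.map B).sum =
      NormedSpace.exp (((1 / r : ℝ) : ℂ) • (js.map B).sum) ^ r := by
    let _ : NormedAlgebra ℚ 𝔸 := NormedAlgebra.restrictScalars ℚ ℂ 𝔸
    rw [← NormedSpace.exp_nsmul, ← Nat.cast_smul_eq_nsmul ℂ, smul_smul]
    have : (r : ℂ) * ((1 / r : ℝ) : ℂ) = 1 := by
      have : (r : ℂ) ≠ 0 := by exact_mod_cast hr.ne'
      push_cast; field_simp
    rw [this, one_smul]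
  rw [hexp]
  refine (norm_pow_sub_pow_le (norm_expProduct_le_one B hB _) (hH _) r).trans ?_
  refine mul_le_mul_of_nonneg_left ?_ hr'.le
  have hsum : ‖(js.map B).sum‖ ≤ (js.map fun i => ‖B i‖).sum := by
    clear hexp hH hB0 hΛ
    induction js with
    | nil => simp
    | cons i js ih =>
      simp only [List.map_cons, List.sum_cons]
      exact (norm_add_le _ _).trans (by gcongr)
  -- Both the formula for time `1/r` and the exact step are majorized with parameter `Λ/r`.
  refine HasMajorant.norm_sub_le
    ((hasMajorant_formalProduct B _).mono (formulaWeight_nonneg _ _) ?_)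
    ((hasMajorant_formalExp _).mono (norm_nonneg _) ?_) (by positivity) hΛr ?_
  · refine (formulaWeight_suzukiFormula_le _ _ _ _).trans ?_
    rw [abs_of_nonneg (by positivity), div_eq_mul_one_div Λ, mul_right_comm]
    gcongr
  · rw [norm_smul, Complex.norm_real, Real.norm_of_nonneg (by positivity), div_eq_mul_one_div Λ,
      mul_comm]
    gcongr
    refine hsum.trans (le_trans ?_ hΛ)
    exact le_mul_of_one_le_left hB0 (one_le_pow₀ (by norm_num))
  · intro j hj
    rw [coeff_formalProduct_suzukiFormula, coeff_formalExp_smul, suzukiFormula_order B js k j hj]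

end ProductFormulaError

/-! ### Bit flips and monomial matrices on basis states. -/

section BitFlips

variable {Q : Type} [DecidableEq Q]

/-- Flip the bit `t` if the predicate `P` holds. -/
def flipIf (t : Q) (P : (Q → Bool) → Bool) (y : Q → Bool) : Q → Bool :=
  Function.update y t (xor (y t) (P y))

theorem flipIf_flipIf (t : Q) (P : (Q → Bool) → Bool)
    (hP : ∀ y b, P (Function.update y t b) = P y) (y : Q → Bool) :
    flipIf t P (flipIf t P y) = y := by
  unfold flipIf
  rw [hP, Function.update_self, Function.update_idem, Bool.xor_assoc, Bool.xor_self,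
    Bool.xor_false, Function.update_eq_self]

theorem forall_ne_eq_iff_update (x y : Q → Bool) (q : Q) :
    (∀ j, j ≠ q → x j = y j) ↔ x = Function.update y q (x q) := by
  rw [Function.eq_update_iff]
  simp

end BitFlips

section BasisMaps

variable {Q : Type} [Fintype Q]

/-- The matrix that maps the basis state `y` to `φ y` times the basis state `f y`. -/
def basisMap (f : (Q → Bool) → Q → Bool) (φ : (Q → Bool) → ℂ) :
    Matrix (Q → Bool) (Q → Bool) ℂ :=
  Matrix.of fun x y => if x = f y then φ y else 0

theorem basisMap_id (φ : (Q → Bool) → ℂ) : basisMap id φ = Matrix.diagonal φ := by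
  ext x y
  simp only [basisMap, Matrix.of_apply, id, Matrix.diagonal_apply]
  split_ifs with h
  · rw [h]
  · rfl

theorem basisMap_id_one : basisMap (id : (Q → Bool) → Q → Bool) 1 = 1 := by
  rw [basisMap_id]; exact Matrix.diagonal_one

end BasisMaps

/-! ### Small circuits: diagonal phases, Hadamard conjugation, Toffoli. -/

section Circuits

variable {Q : Type} [Fintype Q] [DecidableEq Q]

/-- The matrix `M` is performed exactly by some circuit with at most `ℓ` gates. -/
def HasCircuit (M : Matrix (Q → Bool) (Q → Bool) ℂ) (ℓ : ℕ) : Prop :=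
  ∃ c : QuantumCircuit Q, c.length ≤ ℓ ∧ QuantumCircuit.toMatrix c = M

theorem QuantumCircuit.toMatrix_append (c c' : QuantumCircuit Q) :
    QuantumCircuit.toMatrix (c ++ c') =
      QuantumCircuit.toMatrix c' * QuantumCircuit.toMatrix c := by
  induction c with
  | nil => simp [QuantumCircuit.toMatrix]
  | cons g c ih => rw [List.cons_append, toMatrix, toMatrix, ih, Matrix.mul_assoc]

theorem HasCircuit.mul {M M' : Matrix (Q → Bool) (Q → Bool) ℂ} {ℓ ℓ' : ℕ}
    (h : HasCircuit M ℓ) (h' : HasCircuit M' ℓ') : HasCircuit (M * M') (ℓ + ℓ') := by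
  obtain ⟨c, hc, rfl⟩ := h
  obtain ⟨c', hc', rfl⟩ := h'
  refine ⟨c' ++ c, ?_, QuantumCircuit.toMatrix_append _ _⟩
  rw [List.length_append]; omega

theorem HasCircuit.mono {M : Matrix (Q → Bool) (Q → Bool) ℂ} {ℓ ℓ' : ℕ}
    (h : HasCircuit M ℓ) (hℓ : ℓ ≤ ℓ') : HasCircuit M ℓ' := by
  obtain ⟨c, hc, h⟩ := h
  exact ⟨c, hc.trans hℓ, h⟩

theorem hasCircuit_one : HasCircuit (1 : Matrix (Q → Bool) (Q → Bool) ℂ) 0 := ⟨[], le_rfl, rfl⟩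

theorem hasCircuit_gate (g : ElementaryGate Q) : HasCircuit g.toMatrix 1 :=
  ⟨[g], le_rfl, by simp [QuantumCircuit.toMatrix]⟩

theorem basisMap_mul (f g : (Q → Bool) → Q → Bool) (φ ψ : (Q → Bool) → ℂ) :
    basisMap f φ * basisMap g ψ = basisMap (f ∘ g) (fun y => φ (g y) * ψ y) := by
  ext x y
  simp only [basisMap, Matrix.mul_apply, Matrix.of_apply, Function.comp]
  rw [Finset.sum_eq_single (g y)]
  · simp
  · intro z _ hz; simp [hz]
  · simp

/-- The map `f` on basis states is performed exactly by some circuit with at most `ℓ` gates. -/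
def HasClassicalCircuit (f : (Q → Bool) → Q → Bool) (ℓ : ℕ) : Prop := HasCircuit (basisMap f 1) ℓ

theorem HasClassicalCircuit.comp {f g : (Q → Bool) → Q → Bool} {ℓ ℓ' : ℕ}
    (h : HasClassicalCircuit f ℓ) (h' : HasClassicalCircuit g ℓ') :
    HasClassicalCircuit (f ∘ g) (ℓ + ℓ') := by
  have := HasCircuit.mul h h'
  rw [basisMap_mul] at this
  have e : (fun y => (1 : (Q → Bool) → ℂ) (g y) * (1 : (Q → Bool) → ℂ) y) = 1 := by
    funext y; simp
  rwa [e] at this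

theorem hasClassicalCircuit_id : HasClassicalCircuit (id : (Q → Bool) → Q → Bool) 0 := by
  unfold HasClassicalCircuit
  rw [basisMap_id_one]; exact hasCircuit_one

theorem hasClassicalCircuit_cnot {c t : Q} (h : c ≠ t) :
    HasClassicalCircuit (flipIf t fun y => y c) 1 :=
  hasCircuit_gate (.cnot c t h)

theorem sum_agree_off (t : Q) (y : Q → Bool) (F : (Q → Bool) → ℂ) :
    (∑ z, if ∀ j, j ≠ t → z j = y j then F z else 0) =
      F (Function.update y t false) + F (Function.update y t true) := by
  have h : ∀ z : Q → Bool, (∀ j, j ≠ t → z j = y j) ↔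
      z = Function.update y t false ∨ z = Function.update y t true := by
    intro z
    rw [forall_ne_eq_iff_update]
    constructor
    · intro hz
      rcases hb : z t with _ | _ <;> rw [hb] at hz <;> simp [← hz]
    · rintro (rfl | rfl) <;> simp
  simp only [h]
  rw [← Finset.sum_filter, Finset.filter_or, Finset.filter_eq', Finset.filter_eq',
    if_pos (Finset.mem_univ _), if_pos (Finset.mem_univ _), Finset.sum_union, Finset.sum_singleton,
    Finset.sum_singleton]
  rw [Finset.disjoint_singleton]
  intro h'
  simpa using congrFun h' t

/-- A diagonal single-qubit gate. -/
theorem hasCircuit_diagonal_single (q : Q) (p : Bool → ℂ) (hp : ∀ b, p b * star (p b) = 1) :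
    HasCircuit (Matrix.diagonal fun y : Q → Bool => p (y q)) 1 := by
  have hU : Matrix.diagonal p ∈ Matrix.unitaryGroup Bool ℂ := by
    rw [Matrix.mem_unitaryGroup_iff, Matrix.star_eq_conjTranspose, Matrix.diagonal_conjTranspose,
      Matrix.diagonal_mul_diagonal, ← Matrix.diagonal_one]
    congr 1; ext b; exact hp b
  convert hasCircuit_gate (ElementaryGate.single q ⟨_, hU⟩) using 1
  ext x y
  simp only [ElementaryGate.toMatrix, Matrix.of_apply, Matrix.diagonal_apply]
  by_cases h : x = y
  · subst h; simp
  · rw [if_neg h]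
    split_ifs with h1 h2
    · exact absurd (funext fun j => by by_cases hj : j = q; exacts [hj ▸ h2, h1 j hj]) h
    · rfl
    · rfl

theorem hasClassicalCircuit_not (q : Q) : HasClassicalCircuit (flipIf q fun _ => true) 1 := by
  have hU : (Matrix.of fun a b : Bool => if a = !b then (1 : ℂ) else 0) ∈
      Matrix.unitaryGroup Bool ℂ := by
    rw [Matrix.mem_unitaryGroup_iff]
    ext a b
    rw [Matrix.mul_apply, Fintype.sum_bool]
    cases a <;> cases b <;> simp
  unfold HasClassicalCircuit
  convert hasCircuit_gate (ElementaryGate.single q ⟨_, hU⟩) using 1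
  ext x y
  simp only [ElementaryGate.toMatrix, Matrix.of_apply, basisMap, flipIf, Bool.xor_true, ← ite_and,
    Function.eq_update_iff, Pi.one_apply]
  congr 1
  rw [and_comm]

/-- The Hadamard matrix. -/
noncomputable def hadamardMatrix : Matrix Bool Bool ℂ :=
  Matrix.of fun a b => ((Real.sqrt 2)⁻¹ : ℝ) * (if a && b then -1 else 1)

theorem inv_sqrt_two_mul_self : ((((Real.sqrt 2)⁻¹ : ℝ) : ℂ)) * (((Real.sqrt 2)⁻¹ : ℝ) : ℂ) =
    1 / 2 := by
  rw [← Complex.ofReal_mul, ← mul_inv, Real.mul_self_sqrt (by norm_num)]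
  norm_num

theorem hadamardMatrix_mem : hadamardMatrix ∈ Matrix.unitaryGroup Bool ℂ := by
  rw [Matrix.mem_unitaryGroup_iff]
  ext a b
  rw [Matrix.mul_apply, Fintype.sum_bool]
  have h := inv_sqrt_two_mul_self
  push_cast at h
  cases a <;> cases b <;> simp [hadamardMatrix] <;> linear_combination 2 * h

/-- The Hadamard gate on the qubit `t`. -/
noncomputable def hadamardOn (t : Q) : Matrix (Q → Bool) (Q → Bool) ℂ :=
  (ElementaryGate.single t ⟨hadamardMatrix, hadamardMatrix_mem⟩).toMatrix

theorem hasCircuit_hadamardOn (t : Q) : HasCircuit (hadamardOn t) 1 := hasCircuit_gate _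

theorem hadamardOn_apply (t : Q) (x y : Q → Bool) :
    hadamardOn t x y = if ∀ j, j ≠ t → x j = y j then hadamardMatrix (x t) (y t) else 0 := rfl

/-- Conjugating a diagonal matrix by a Hadamard gate. -/
theorem hadamardOn_mul_diagonal_mul (t : Q) (d : (Q → Bool) → ℂ) :
    hadamardOn t * Matrix.diagonal d * hadamardOn t =
      Matrix.diagonal (fun y =>
        (d (Function.update y t false) + d (Function.update y t true)) / 2) +
      basisMap (flipIf t fun _ => true) (fun y =>
        (d (Function.update y t false) - d (Function.update y t true)) / 2) := by
  ext x y
  rw [Matrix.mul_apply]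
  simp only [Matrix.mul_diagonal, hadamardOn_apply _ _ y, mul_ite, mul_zero]
  rw [sum_agree_off t y (fun z => hadamardOn t x z * d z * hadamardMatrix (z t) (y t))]
  simp only [hadamardOn_apply, Matrix.add_apply, Matrix.diagonal_apply, basisMap, Matrix.of_apply,
    flipIf, Bool.xor_true, Function.update_self]
  have hagree : ∀ b, (∀ j, j ≠ t → x j = Function.update y t b j) ↔ ∀ j, j ≠ t → x j = y j :=
    fun b => forall₂_congr fun j hj => by rw [Function.update_of_ne hj]
  simp only [hagree]
  have h2 := inv_sqrt_two_mul_self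
  push_cast at h2
  by_cases h : ∀ j, j ≠ t → x j = y j
  · simp only [if_pos h]
    have hx := (forall_ne_eq_iff_update x y t).mp h
    have e1 : x = y ↔ x t = y t := by
      constructor
      · rintro rfl; rfl
      · intro h'; rw [hx, h', Function.update_eq_self]
    have e2 : x = Function.update y t (!y t) ↔ x t = !y t := by
      constructor
      · intro h'; rw [h', Function.update_self]
      · intro h'; rw [← h']; exact hx
    have e3 : ∀ b, Function.update x t b = Function.update y t b := fun b => by
      funext j
      by_cases hj : j = t
      · subst hj; simp
      · simp [hj, h j hj]
    simp only [e1, e2, e3]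
    cases x t <;> cases y t <;> simp [hadamardMatrix]
    · linear_combination (d (Function.update y t false) + d (Function.update y t true)) * h2
    · linear_combination (d (Function.update y t false) - d (Function.update y t true)) * h2
    · linear_combination (d (Function.update y t false) - d (Function.update y t true)) * h2
    · linear_combination (d (Function.update y t false) + d (Function.update y t true)) * h2
  · have e1 : x ≠ y := fun h' => h fun j _ => by rw [h']
    have e2 : x ≠ Function.update y t (!y t) := fun h' => h fun j hj => by
      rw [h', Function.update_of_ne hj]
    simp [h, e1, e2]

theorem hadamardOn_mul_self (t : Q) : hadamardOn t * hadamardOn t = 1 := by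
  have h := hadamardOn_mul_diagonal_mul t (fun _ : Q → Bool => (1 : ℂ))
  have hz : basisMap (flipIf t fun _ => true) (fun _ : Q → Bool => (0 : ℂ)) = 0 := by
    ext x y; simp [basisMap]
  simpa [hz] using h

/-- Hadamard gates turn a controlled sign into a controlled flip. -/
theorem hadamardOn_conj_sign (t : Q) (P : (Q → Bool) → Bool)
    (hP : ∀ y b, P (Function.update y t b) = P y) :
    hadamardOn t * Matrix.diagonal (fun y => if P y && y t then -1 else 1) * hadamardOn t =
      basisMap (flipIf t P) 1 := by
  rw [hadamardOn_mul_diagonal_mul]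
  ext x y
  simp only [hP, Function.update_self, Matrix.add_apply, Matrix.diagonal_apply, basisMap, flipIf,
    Matrix.of_apply]
  by_cases hxy : x = y
  · subst hxy
    by_cases hPx : P x = true <;> simp [hPx]
  · by_cases hPy : P y = true <;> simp [hxy, hPy]

/-- Hadamard gates turn a phase flip that is present only where `P` holds into a bit flip. -/
theorem hadamardOn_conj_indicator (t : Q) (P : (Q → Bool) → Bool)
    (hP : ∀ y b, P (Function.update y t b) = P y) :
    hadamardOn t * Matrix.diagonal (fun y => if P y then (if y t then -1 else 1) else 0) *
      hadamardOn t = basisMap (flipIf t fun _ => true) (fun y => if P y then 1 else 0) := by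
  rw [hadamardOn_mul_diagonal_mul]
  ext x y
  simp only [hP, Function.update_self, Matrix.add_apply, Matrix.diagonal_apply, basisMap, flipIf,
    Matrix.of_apply]
  by_cases hxy : x = y
  · subst hxy
    by_cases hPx : P x = true <;> simp [hPx]
  · by_cases hPy : P y = true <;> simp [hxy, hPy]

theorem HasCircuit.diagonal_mul {d e : (Q → Bool) → ℂ} {ℓ ℓ' : ℕ}
    (h : HasCircuit (Matrix.diagonal d) ℓ) (h' : HasCircuit (Matrix.diagonal e) ℓ') :
    HasCircuit (Matrix.diagonal fun y => d y * e y) (ℓ + ℓ') := by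
  rw [← Matrix.diagonal_mul_diagonal]
  exact h.mul h'

/-- Conjugating a diagonal matrix by an involution of the basis states. -/
theorem HasCircuit.diagonal_conj {d : (Q → Bool) → ℂ} {f : (Q → Bool) → Q → Bool} {ℓ ℓ' : ℕ}
    (h : HasCircuit (Matrix.diagonal d) ℓ) (hf : HasClassicalCircuit f ℓ')
    (hff : ∀ y, f (f y) = y) :
    HasCircuit (Matrix.diagonal fun y => d (f y)) (ℓ' + ℓ + ℓ') := by
  have := (HasCircuit.mul hf h).mul hf
  rw [← basisMap_id, basisMap_mul, basisMap_mul] at this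
  rw [← basisMap_id]
  convert this using 2
  · funext y; exact (hff y).symm
  · simp

theorem HasCircuit.diagonal_cnot_conj {d : (Q → Bool) → ℂ} {c t : Q} {ℓ : ℕ}
    (h : HasCircuit (Matrix.diagonal d) ℓ) (hct : c ≠ t) :
    HasCircuit (Matrix.diagonal fun y => d (flipIf t (fun y => y c) y)) (ℓ + 2) := by
  refine (h.diagonal_conj (hasClassicalCircuit_cnot hct) (flipIf_flipIf t _ fun y b => ?_)).mono
    (by omega)
  rw [Function.update_of_ne hct]

/-- The doubly controlled sign, as a product of phases depending on parities. -/
theorem hasCircuit_ccz {a b t : Q} (hab : a ≠ b) (hat : a ≠ t) (hbt : b ≠ t) :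
    HasCircuit (Matrix.diagonal fun y : Q → Bool => if (y a && y b) && y t then (-1 : ℂ) else 1)
      17 := by
  -- With `ω = e^{iπ/4}`, the sign `(-1)^{abt} = ω^{4abt}` splits into single-qubit phases on
  -- parities: `4abt = a + b + t - (a⊕b) - (a⊕t) - (b⊕t) + (a⊕b⊕t)`. CNOT conjugation produces the
  -- parities.
  obtain ⟨ω, hω, hω4⟩ : ∃ ω : ℂ, ω * star ω = 1 ∧ ω ^ 4 = -1 := by
    refine ⟨Complex.exp ((Real.pi / 4 : ℝ) * Complex.I), ?_, ?_⟩
    · rw [Complex.star_def, Complex.mul_conj, Complex.normSq_eq_norm_sq,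
        Complex.norm_exp_ofReal_mul_I]
      simp
    · rw [← Complex.exp_nat_mul, ← Complex.exp_pi_mul_I]
      congr 1; push_cast; ring
  have hω' : star ω * star (star ω) = 1 := by rw [star_star, mul_comm]; exact hω
  have single : ∀ (q : Q) (z : ℂ), z * star z = 1 →
      HasCircuit (Matrix.diagonal fun y : Q → Bool => if y q then z else 1) 1 := fun q z hz =>
    hasCircuit_diagonal_single q (fun b => if b then z else 1) (fun b => by
      cases b
      · simp
      · simpa using hz)
  have hA := single a ω hω
  have hB := single b ω hω
  have hT := single t ω hω
  have hAB := (single b (star ω) hω').diagonal_cnot_conj hab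
  have hAT := (single t (star ω) hω').diagonal_cnot_conj hat
  have hBT := (single t (star ω) hω').diagonal_cnot_conj hbt
  have hABT := ((single t ω hω).diagonal_cnot_conj hat).diagonal_cnot_conj hbt
  refine HasCircuit.mono (ℓ := (((((1 + 1) + 1) + 3) + 3) + 3) + 5) ?_ (by norm_num)
  convert (((((hA.diagonal_mul hB).diagonal_mul hT).diagonal_mul hAB).diagonal_mul
    hAT).diagonal_mul hBT).diagonal_mul hABT using 2
  funext y
  simp only [flipIf, Function.update_self, Function.update_of_ne hat, Function.update_of_ne hbt,
    Function.update_of_ne hab]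
  rcases y a <;> rcases y b <;> rcases y t <;> simp only [Bool.xor_true, Bool.xor_false,
    Bool.and_true, Bool.and_false, Bool.false_eq_true, if_true, if_false, mul_one, one_mul,
    Bool.not_true, Bool.not_false]
  · linear_combination (-ω * star ω - 1) * hω
  · linear_combination (-ω * star ω - 1) * hω
  · linear_combination (-ω * star ω - 1) * hω
  · linear_combination (-ω * star ω - 1) * hω
  · linear_combination (-ω * star ω - 1) * hω
  · linear_combination (-ω * star ω - 1) * hω
  · linear_combination -hω4

/-- The Toffoli gate. -/
theorem hasClassicalCircuit_toffoli {a b t : Q} (hab : a ≠ b) (hat : a ≠ t) (hbt : b ≠ t) :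
    HasClassicalCircuit (flipIf t fun y => y a && y b) 19 := by
  unfold HasClassicalCircuit
  rw [← hadamardOn_conj_sign t (fun y => y a && y b) fun y c => by
    rw [Function.update_of_ne hat, Function.update_of_ne hbt]]
  exact ((hasCircuit_hadamardOn t).mul (hasCircuit_ccz hab hat hbt)).mul (hasCircuit_hadamardOn t)

end Circuits

/-! ### Multiply controlled flips with borrowed bits. -/

section Ladder

/-- The conjunction of the bits `b 0, …, b j`. -/
def andUpTo (b : ℕ → Bool) : ℕ → Bool
  | 0 => b 0
  | j + 1 => andUpTo b j && b (j + 1)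

theorem andUpTo_eq_true_iff (b : ℕ → Bool) (j : ℕ) :
    andUpTo b j = true ↔ ∀ i ≤ j, b i = true := by
  induction j with
  | zero => simp [andUpTo]
  | succ j ih =>
    rw [andUpTo, Bool.and_eq_true, ih]
    constructor
    · rintro ⟨h1, h2⟩ i hi
      rcases Nat.le_succ_iff.mp hi with hi | rfl
      exacts [h1 i hi, h2]
    · exact fun h => ⟨fun i hi => h i (by omega), h _ le_rfl⟩

theorem andUpTo_congr {b b' : ℕ → Bool} {j : ℕ} (h : ∀ i ≤ j, b i = b' i) :
    andUpTo b j = andUpTo b' j := by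
  induction j with
  | zero => exact h 0 le_rfl
  | succ j ih => rw [andUpTo, andUpTo, ih fun i hi => h i (by omega), h _ le_rfl]

variable {Q : Type} [DecidableEq Q]

/-- A ladder of Toffoli gates: it adds to each bit `a i` with `i ≤ j` the conjunction of the control
bits `c 0, …, c i`, see `ladderMap_target`. -/
def ladderMap (c a : ℕ → Q) : ℕ → (Q → Bool) → Q → Bool
  | 0 => flipIf (a 0) fun z => z (c 0)
  | j + 1 => flipIf (a (j + 1)) (fun z => z (a j) && z (c (j + 1))) ∘
      (ladderMap c a j ∘ flipIf (a (j + 1)) fun z => z (a j) && z (c (j + 1)))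

theorem flipIf_of_ne {t q : Q} (P : (Q → Bool) → Bool) (y : Q → Bool) (h : q ≠ t) :
    flipIf t P y q = y q := Function.update_of_ne h _ _

theorem flipIf_self (t : Q) (P : (Q → Bool) → Bool) (y : Q → Bool) :
    flipIf t P y t = xor (y t) (P y) := Function.update_self _ _ _

theorem ladderMap_of_ne (c a : ℕ → Q) (j : ℕ) (z : Q → Bool) (q : Q) (hq : ∀ i ≤ j, q ≠ a i) :
    ladderMap c a j z q = z q := by
  induction j generalizing z with
  | zero => exact flipIf_of_ne _ _ (hq 0 le_rfl)
  | succ j ih =>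
    simp only [ladderMap, Function.comp]
    rw [flipIf_of_ne _ _ (hq _ le_rfl), ih _ fun i hi => hq i (by omega),
      flipIf_of_ne _ _ (hq _ le_rfl)]

theorem ladderMap_target (c a : ℕ → Q) (j : ℕ) (hac : ∀ i ≤ j, ∀ i' ≤ j, a i ≠ c i')
    (ha : ∀ i ≤ j, ∀ i' < i, a i' ≠ a i) (z : Q → Bool) (i : ℕ) (hi : i ≤ j) :
    ladderMap c a j z (a i) = xor (z (a i)) (andUpTo (fun i => z (c i)) i) := by
  induction j generalizing z i with
  | zero =>
    obtain rfl : i = 0 := by omega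
    exact flipIf_self _ _ _
  | succ j ih =>
    have ih' := fun z i hi => ih (fun i hi i' hi' => hac i (by omega) i' (by omega))
      (fun i hi i' hi' => ha i (by omega) i' hi') z i hi
    simp only [ladderMap, Function.comp]
    set z1 := flipIf (a (j + 1)) (fun z => z (a j) && z (c (j + 1))) z with hz1
    have hz1c : ∀ i ≤ j + 1, z1 (c i) = z (c i) := fun i hi =>
      flipIf_of_ne _ _ (hac _ le_rfl _ hi).symm
    have hz1a : ∀ i ≤ j, z1 (a i) = z (a i) := fun i hi =>
      flipIf_of_ne _ _ (ha _ le_rfl _ (by omega))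
    have hand : ∀ i ≤ j, andUpTo (fun i => z1 (c i)) i = andUpTo (fun i => z (c i)) i :=
      fun i hi => andUpTo_congr fun i' hi' => hz1c i' (by omega)
    rcases Nat.le_succ_iff.mp hi with hi | rfl
    · rw [flipIf_of_ne _ _ (ha _ le_rfl _ (by omega)), ih' _ _ hi, hz1a i hi, hand i hi]
    -- The two outer Toffolis see `a j` before and after the inner ladder. The values differ by the
    -- conjunction up to `j`, so exactly this, multiplied by `c (j + 1)`, survives in `a (j + 1)`.
    · rw [flipIf_self, ih' _ _ le_rfl, hz1a _ le_rfl, hand _ le_rfl,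
        ladderMap_of_ne _ _ _ _ _ fun i hi => (ha _ le_rfl _ (by omega)).symm,
        ladderMap_of_ne _ _ _ _ (c _) fun i hi => (hac _ (by omega) _ le_rfl).symm,
        hz1c _ le_rfl, hz1, flipIf_self, andUpTo]
      cases z (a (j + 1)) <;> cases z (a j) <;> cases z (c (j + 1)) <;>
        cases andUpTo (fun i => z (c i)) j <;> rfl

/-- The shorter ladder cancels what the longer one does to the borrowed bits `a 0, …, a j`, whatever
their values, and leaves only the flip of `a (j + 1)`. -/
theorem ladderMap_succ_comp (c a : ℕ → Q) (j : ℕ) (hac : ∀ i ≤ j + 1, ∀ i' ≤ j + 1, a i ≠ c i')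
    (ha : ∀ i ≤ j + 1, ∀ i' < i, a i' ≠ a i) :
    ladderMap c a (j + 1) ∘ ladderMap c a j =
      flipIf (a (j + 1)) fun z => andUpTo (fun i => z (c i)) (j + 1) := by
  funext z q
  have hc : ∀ i ≤ j + 1, ladderMap c a j z (c i) = z (c i) := fun i hi =>
    ladderMap_of_ne _ _ _ _ _ fun i' hi' => (hac _ (by omega) _ hi).symm
  have hand : ∀ i ≤ j + 1, andUpTo (fun i => ladderMap c a j z (c i)) i =
      andUpTo (fun i => z (c i)) i :=
    fun i hi => andUpTo_congr fun i' hi' => hc i' (by omega)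
  have hlast : ladderMap c a j z (a (j + 1)) = z (a (j + 1)) :=
    ladderMap_of_ne _ _ _ _ _ fun i hi => (ha _ le_rfl _ (by omega)).symm
  rw [Function.comp]
  by_cases hq : ∃ i ≤ j + 1, q = a i
  · obtain ⟨i, hi, rfl⟩ := hq
    rw [ladderMap_target c a _ hac ha _ _ hi, hand i hi]
    rcases Nat.le_succ_iff.mp hi with hi | rfl
    · rw [flipIf_of_ne _ _ (ha _ le_rfl _ (by omega)), ladderMap_target c a j
        (fun i hi i' hi' => hac i (by omega) i' (by omega))
        (fun i hi i' hi' => ha i (by omega) i' hi') _ _ hi, Bool.xor_assoc, Bool.xor_self,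
        Bool.xor_false]
    · rw [flipIf_self, hlast]
  · push Not at hq
    rw [ladderMap_of_ne _ _ _ _ _ hq, ladderMap_of_ne _ _ _ _ _ fun i hi => hq i (by omega),
      flipIf_of_ne _ _ (hq _ le_rfl)]

/-- The commutator of two controlled flips is a flip controlled by both. -/
theorem flipIf_commutator {b t : Q} (hbt : b ≠ t) (P R : (Q → Bool) → Bool)
    (hPb : ∀ y v, P (Function.update y b v) = P y) (hPt : ∀ y v, P (Function.update y t v) = P y)
    (hRb : ∀ y v, R (Function.update y b v) = R y) (hRt : ∀ y v, R (Function.update y t v) = R y) :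
    flipIf t (fun z => z b && R z) ∘ flipIf b P ∘ flipIf t (fun z => z b && R z) ∘ flipIf b P =
      flipIf t fun z => P z && R z := by
  funext z q
  have h1 : ∀ y, P (flipIf b P y) = P y := fun y => hPb _ _
  have h2 : ∀ y, R (flipIf b P y) = R y := fun y => hRb _ _
  have h3 : ∀ y, P (flipIf t (fun z => z b && R z) y) = P y := fun y => hPt _ _
  have h4 : ∀ y, R (flipIf t (fun z => z b && R z) y) = R y := fun y => hRt _ _
  simp only [Function.comp]
  by_cases hqt : q = t
  · subst hqt
    simp only [flipIf_self, flipIf_of_ne _ _ hbt, flipIf_of_ne _ _ hbt.symm, h1, h2, h3, h4]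
    cases z q <;> cases z b <;> cases P z <;> cases R z <;> rfl
  · rw [flipIf_of_ne _ _ hqt, flipIf_of_ne _ _ hqt]
    by_cases hqb : q = b
    · subst hqb
      simp only [flipIf_self, flipIf_of_ne _ _ hbt, h1, h3]
      cases z q <;> cases P z <;> rfl
    · simp only [flipIf_of_ne _ _ hqt, flipIf_of_ne _ _ hqb]

variable [Fintype Q]

theorem hasClassicalCircuit_ladderMap (c a : ℕ → Q) (j : ℕ)
    (hac : ∀ i ≤ j, ∀ i' ≤ j, a i ≠ c i') (ha : ∀ i ≤ j, ∀ i' < i, a i' ≠ a i) :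
    HasClassicalCircuit (ladderMap c a j) (19 * (2 * j + 1)) := by
  induction j with
  | zero => exact (hasClassicalCircuit_cnot (hac 0 le_rfl 0 le_rfl).symm).mono (by norm_num)
  | succ j ih =>
    have htof : HasClassicalCircuit (flipIf (a (j + 1)) fun z => z (a j) && z (c (j + 1))) 19 :=
      hasClassicalCircuit_toffoli (hac _ (by omega) _ le_rfl) (ha _ le_rfl _ (by omega))
        (hac _ le_rfl _ le_rfl).symm
    refine (htof.comp ((ih (fun i hi i' hi' => hac i (by omega) i' (by omega))
      (fun i hi i' hi' => ha i (by omega) i' hi')).comp htof)).mono (by ring_nf; omega)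

/-- A flip with `j + 1` controls, with `j` borrowed bits. -/
theorem hasClassicalCircuit_flipIf_andUpTo (c a : ℕ → Q) (j : ℕ)
    (hac : ∀ i ≤ j, ∀ i' ≤ j, a i ≠ c i') (ha : ∀ i ≤ j, ∀ i' < i, a i' ≠ a i) :
    HasClassicalCircuit (flipIf (a j) fun z => andUpTo (fun i => z (c i)) j)
      (19 * (4 * j + 1)) := by
  cases j with
  | zero => exact (hasClassicalCircuit_ladderMap c a 0 hac ha).mono (by norm_num)
  | succ j =>
    rw [← ladderMap_succ_comp c a j hac ha]
    refine ((hasClassicalCircuit_ladderMap c a _ hac ha).comp (hasClassicalCircuit_ladderMap c a j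
      (fun i hi i' hi' => hac i (by omega) i' (by omega))
      (fun i hi i' hi' => ha i (by omega) i' hi'))).mono (by ring_nf; omega)

/-- A flip with `m` controls, with a single borrowed bit `b`. -/
theorem hasClassicalCircuit_flipIf_all (e : ℕ → Q) (m : ℕ) (hm : 0 < m)
    (he : ∀ i < m, ∀ i' < m, e i = e i' → i = i') (b t : Q) (hbt : b ≠ t)
    (hb : ∀ i < m, e i ≠ b) (ht : ∀ i < m, e i ≠ t) (P : (Q → Bool) → Bool)
    (hP : ∀ z, P z = true ↔ ∀ i < m, z (e i) = true) :
    HasClassicalCircuit (flipIf t P) (152 * m) := by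
  -- The controls are halved: `j + 1 = ⌈m/2⌉` and `l = m - (j + 1)`. Each half lends its bits to the
  -- flip controlled by the other half, and the commutator through `b` joins them.
  obtain ⟨j, hj⟩ : ∃ j, (m + 1) / 2 = j + 1 := ⟨(m + 1) / 2 - 1, by omega⟩
  obtain ⟨l, hl⟩ : ∃ l, m = j + 1 + l := ⟨m - (j + 1), by omega⟩
  have hA := hasClassicalCircuit_flipIf_andUpTo e (fun i => if i < j then e (j + 1 + i) else b) j
    (fun i hi i' hi' => by
      split_ifs
      · exact fun h => by have := he _ (by omega) _ (by omega) h; omega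
      · exact (hb _ (by omega)).symm)
    (fun i hi i' hi' => by
      rw [if_pos (by omega)]
      split_ifs
      · exact fun h => by have := he _ (by omega) _ (by omega) h; omega
      · exact hb _ (by omega))
  -- Here `b` is control number 0, followed by the second half; `l ≤ j + 1` leaves enough bits of
  -- the first half to borrow.
  have hB := hasClassicalCircuit_flipIf_andUpTo (fun i => if i = 0 then b else e (j + i))
    (fun i => if i < l then e i else t) l
    (fun i hi i' hi' => by
      split_ifs
      · exact hb _ (by omega)
      · exact fun h => by have := he _ (by omega) _ (by omega) h; omega
      · exact hbt.symm
      · exact (ht _ (by omega)).symm)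
    (fun i hi i' hi' => by
      rw [if_pos (by omega)]
      split_ifs
      · exact fun h => by have := he _ (by omega) _ (by omega) h; omega
      · exact ht _ (by omega))
  simp only [lt_irrefl, if_false] at hA hB
  set R : (Q → Bool) → Bool := fun z => decide (∀ i < l, z (e (j + 1 + i)) = true) with hR
  have hBR : (fun z : Q → Bool => andUpTo (fun i => z (if i = 0 then b else e (j + i))) l) =
      fun z => z b && R z := by
    funext z
    rw [Bool.eq_iff_iff, andUpTo_eq_true_iff, Bool.and_eq_true, hR, decide_eq_true_iff]
    constructor
    · refine fun h => ⟨by simpa using h 0 (by omega), fun i hi => ?_⟩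
      have := h (i + 1) (by omega)
      rwa [if_neg (by omega), show j + (i + 1) = j + 1 + i by ring] at this
    · rintro ⟨h0, h⟩ i hi
      rcases i with _ | i
      · simpa using h0
      · rw [if_neg (by omega), show j + (i + 1) = j + 1 + i by ring]
        exact h i (by omega)
  rw [hBR] at hB
  have hcomm := flipIf_commutator hbt (fun z => andUpTo (fun i => z (e i)) j) R
    (fun y v => andUpTo_congr fun i hi => Function.update_of_ne (hb _ (by omega)) _ _)
    (fun y v => andUpTo_congr fun i hi => Function.update_of_ne (ht _ (by omega)) _ _)
    (fun y v => by
      simp only [hR]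
      congr 1
      refine propext (forall₂_congr fun i hi => ?_)
      rw [Function.update_of_ne (hb _ (by omega))])
    (fun y v => by
      simp only [hR]
      congr 1
      refine propext (forall₂_congr fun i hi => ?_)
      rw [Function.update_of_ne (ht _ (by omega))])
  have hPe : (fun z => andUpTo (fun i => z (e i)) j && R z) = P := by
    funext z
    rw [Bool.eq_iff_iff, hP, Bool.and_eq_true, andUpTo_eq_true_iff, hR, decide_eq_true_iff]
    constructor
    · rintro ⟨h1, h2⟩ i hi
      by_cases hij : i ≤ j
      · exact h1 i hij
      · have := h2 (i - (j + 1)) (by omega)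
        rwa [show j + 1 + (i - (j + 1)) = i by omega] at this
    · exact fun h => ⟨fun i hi => h i (by omega), fun i hi => h _ (by omega)⟩
  rw [← hPe, ← hcomm]
  -- The total is `2 * 19 * (4j + 1 + 4l + 1) = 152 (m - 1) + 76`, using `j + l = m - 1`.
  exact (hB.comp (hA.comp (hB.comp hA))).mono (by omega)

end Ladder

/-! ### Shears and a fully controlled phase. -/

section Rotation

variable {n : ℕ}

/-- The working qubits other than `q` all carry a one. -/
def allOnesOff (q : Fin n) (z : Fin n ⊕ Fin 1 → Bool) : Bool :=
  decide (∀ j, j ≠ q → z (.inl j) = true)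

theorem allOnesOff_update (q : Fin n) (z : Fin n ⊕ Fin 1 → Bool) (v : Bool) :
    allOnesOff q (Function.update z (.inl q) v) = allOnesOff q z := by
  unfold allOnesOff
  congr 1
  refine propext (forall₂_congr fun j hj => ?_)
  rw [Function.update_of_ne (by simpa using hj)]

theorem hasClassicalCircuit_allOnesOff (q : Fin n) :
    HasClassicalCircuit (flipIf (.inl q) (allOnesOff q)) (152 * n) := by
  obtain ⟨m, rfl⟩ : ∃ m, n = m + 1 := ⟨n - 1, by have := q.pos; omega⟩
  -- On a single working qubit there are no controls and the flip is a plain NOT; otherwise the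
  -- ancilla is the borrowed bit.
  rcases Nat.eq_zero_or_pos m with rfl | hm
  · have : allOnesOff q = fun _ => true := by
      funext z
      simp only [allOnesOff, decide_eq_true_iff]
      exact fun j hj => absurd (Fin.ext (by omega)) hj
    rw [this]
    exact (hasClassicalCircuit_not _).mono (by norm_num)
  · refine HasCircuit.mono (hasClassicalCircuit_flipIf_all
      (fun i => if h : i < m then Sum.inl (q.succAbove ⟨i, h⟩) else Sum.inr 0) m hm ?_ (.inr 0) _
      (by simp) ?_ ?_ _ ?_) (by omega : 152 * m ≤ 152 * (m + 1))
    · intro i hi i' hi' h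
      simpa [hi, hi'] using h
    · intro i hi; simp [hi]
    · intro i hi; simp [hi, Fin.succAbove_ne]
    · intro z
      rw [allOnesOff, decide_eq_true_iff]
      constructor
      · intro h i hi
        rw [dif_pos hi]
        exact h _ (Fin.succAbove_ne _ _)
      · intro h j hj
        obtain ⟨i, rfl⟩ := Fin.exists_succAbove_eq hj
        simpa using h i i.2

/-- Add to each bit outside `q` the affine function `D · z_q + K` of the bit `q`. -/
def affineShear {Q : Type} [DecidableEq Q] (q : Q) (D K : Q → Bool) (s : Finset Q)
    (z : Q → Bool) (x : Q) : Bool :=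
  if x ∈ s then xor (z x) (xor (D x && z q) (K x)) else z x

theorem hasClassicalCircuit_affineShear {Q : Type} [Fintype Q] [DecidableEq Q] (q : Q)
    (D K : Q → Bool) (s : Finset Q) (hq : q ∉ s) :
    HasClassicalCircuit (affineShear q D K s) (2 * s.card) := by
  induction s using Finset.induction_on with
  | empty =>
    have : affineShear q D K ∅ = id := by funext z x; simp [affineShear]
    rw [this]
    exact hasClassicalCircuit_id
  | insert x s hx ih =>
    rw [Finset.mem_insert, not_or] at hq
    have hD : HasClassicalCircuit (flipIf x fun z => D x && z q) 1 := by
      cases D x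
      · have : (flipIf x fun z => false && z q) = id := by funext z; simp [flipIf]
        rw [this]
        exact HasCircuit.mono hasClassicalCircuit_id (by norm_num)
      · simpa using hasClassicalCircuit_cnot hq.1
    have hK : HasClassicalCircuit (flipIf x fun _ => K x) 1 := by
      cases K x
      · have : (flipIf x fun _ => false) = id := by funext z; simp [flipIf]
        rw [this]
        exact HasCircuit.mono hasClassicalCircuit_id (by norm_num)
      · exact hasClassicalCircuit_not x
    have : affineShear q D K (insert x s) =
        (flipIf x fun _ => K x) ∘ (flipIf x fun z => D x && z q) ∘ affineShear q D K s := by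
      funext z y
      simp only [Function.comp]
      by_cases hy : y = x
      · subst hy
        simp [flipIf, affineShear, hx, hq.2]
      · rw [flipIf_of_ne _ _ hy, flipIf_of_ne _ _ hy]
        simp [affineShear, hy]
    rw [this, Finset.card_insert_of_notMem hx]
    exact (hK.comp (hD.comp (ih hq.2))).mono (by omega)

theorem affineShear_affineShear {Q : Type} [DecidableEq Q] (q : Q) (D K : Q → Bool) (s : Finset Q)
    (hq : q ∉ s) (z : Q → Bool) :
    affineShear q D K s (affineShear q D K s z) = z := by
  funext x
  simp only [affineShear, hq, if_false]
  split_ifs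
  · rw [Bool.xor_assoc, Bool.xor_self, Bool.xor_false]
  · rfl

theorem exp_conj_of_mul_eq_one {m : Type*} [Fintype m] [DecidableEq m] {U V : Matrix m m ℂ}
    (hUV : U * V = 1) (A : Matrix m m ℂ) :
    NormedSpace.exp (U * A * V) = U * NormedSpace.exp A * V :=
  Matrix.exp_units_conj ⟨U, V, hUV, mul_eq_one_comm.mp hUV⟩ A

/-- The phases `e^{∓iθ}` on the qubit `q`, applied only where the other working qubits are one. -/
theorem hasCircuit_controlled_phase (q : Fin n) (θ : ℝ) :
    HasCircuit (Matrix.diagonal fun z : Fin n ⊕ Fin 1 → Bool =>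
      if allOnesOff q z then
        (if z (.inl q) then Complex.exp (θ * Complex.I) else Complex.exp (-(θ * Complex.I))) else 1)
      (304 * n + 2) := by
  -- Half phases: `p(z_q)` is followed by `p(¬z_q)` conjugated by the controlled flip. Without the
  -- flip they cancel, with it they give `p(z_q)²`.
  set p : Bool → ℂ := fun b =>
    if b then Complex.exp ((θ / 2 : ℝ) * Complex.I) else Complex.exp ((-(θ / 2) : ℝ) * Complex.I)
    with hp
  have hunit : ∀ x : ℝ, Complex.exp (x * Complex.I) * star (Complex.exp (x * Complex.I)) = 1 := by
    intro x
    rw [Complex.star_def, Complex.mul_conj, Complex.normSq_eq_norm_sq,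
      Complex.norm_exp_ofReal_mul_I]
    simp
  have hpp : p true * p false = 1 := by
    simp only [hp, if_true, Bool.false_eq_true, if_false]
    rw [← Complex.exp_add, ← Complex.exp_zero]
    congr 1; push_cast; ring
  have hsq : ∀ b, p b * p b =
      if b then Complex.exp (θ * Complex.I) else Complex.exp (-(θ * Complex.I)) := by
    intro b
    cases b <;> simp only [hp, if_true, Bool.false_eq_true, if_false] <;>
      rw [← Complex.exp_add] <;> congr 1 <;> push_cast <;> ring
  have hpu : ∀ b, p b * star (p b) = 1 := fun b => by
    cases b <;> simp only [hp, if_true, Bool.false_eq_true, if_false] <;> exact hunit _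
  have hD := hasCircuit_diagonal_single (Q := Fin n ⊕ Fin 1) (.inl q) p hpu
  have hD' := hasCircuit_diagonal_single (Q := Fin n ⊕ Fin 1) (.inl q) (fun b => p !b)
    fun b => hpu _
  have hE := hD'.diagonal_conj (hasClassicalCircuit_allOnesOff q)
    (flipIf_flipIf _ _ fun y b => allOnesOff_update q y b)
  refine HasCircuit.mono ?_ (by omega : 1 + (152 * n + 1 + 152 * n) ≤ 304 * n + 2)
  convert hD.diagonal_mul hE using 2
  funext z
  rw [flipIf_self]
  cases allOnesOff q z
  · cases z (.inl q)
    · simpa [mul_comm] using hpp.symm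
    · simpa using hpp.symm
  · rw [Bool.xor_true, Bool.not_not, hsq]; simp

end Rotation

/-! ### Exact circuits for two-level rotations. -/

section ExactCircuits

/-- Intertwining passes to powers and then to the exponential series. Thus the exponential of an
edge can be computed on the full register. -/
theorem exp_mul_of_mul_eq {m n : Type*} [Fintype m] [DecidableEq m] [Fintype n] [DecidableEq n]
    {M : Matrix m m ℂ} {E : Matrix n n ℂ} {J : Matrix m n ℂ} (h : M * J = J * E) :
    NormedSpace.exp M * J = J * NormedSpace.exp E := by
  have hpow : ∀ j : ℕ, M ^ j * J = J * E ^ j := by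
    intro j
    induction j with
    | zero => simp
    | succ j ih => rw [pow_succ, Matrix.mul_assoc, h, ← Matrix.mul_assoc, ih, Matrix.mul_assoc,
        ← pow_succ]
  have h1 := (NormedSpace.exp_series_hasSum_exp' (𝕂 := ℂ) M).map
    (AddMonoidHom.mk' (fun X : Matrix m m ℂ => X * J) fun X Y => Matrix.add_mul X Y J)
    (Continuous.matrix_mul continuous_id continuous_const)
  have h2 := (NormedSpace.exp_series_hasSum_exp' (𝕂 := ℂ) E).map
    (AddMonoidHom.mk' (fun X : Matrix n n ℂ => J * X) fun X Y => Matrix.mul_add J X Y)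
    (Continuous.matrix_mul continuous_const continuous_id)
  refine h1.unique ?_
  convert h2 using 1
  · funext j
    simp [hpow]
  · rfl

variable {V : Type} [Fintype V] {n : ℕ}

/-- Some circuit with one ancilla and at most `ℓ` gates implements `U` without error. -/
def HasExactCircuit (enc : V ≃ (Fin n → Bool)) (U : Matrix V V ℂ) (ℓ : ℕ) : Prop :=
  ∃ c : QuantumCircuit (Fin n ⊕ Fin 1), c.length ≤ ℓ ∧
    c.toMatrix * ancillaIsometry enc 1 = ancillaIsometry enc 1 * U

variable {enc : V ≃ (Fin n → Bool)}

theorem HasExactCircuit.mul {U U' : Matrix V V ℂ} {ℓ ℓ' : ℕ} (h : HasExactCircuit enc U ℓ)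
    (h' : HasExactCircuit enc U' ℓ') : HasExactCircuit enc (U * U') (ℓ + ℓ') := by
  obtain ⟨c, hc, hU⟩ := h
  obtain ⟨c', hc', hU'⟩ := h'
  refine ⟨c' ++ c, by rw [List.length_append]; omega, ?_⟩
  rw [QuantumCircuit.toMatrix_append, Matrix.mul_assoc, hU', ← Matrix.mul_assoc, hU,
    Matrix.mul_assoc]

theorem HasExactCircuit.mono {U : Matrix V V ℂ} {ℓ ℓ' : ℕ} (h : HasExactCircuit enc U ℓ)
    (hℓ : ℓ ≤ ℓ') : HasExactCircuit enc U ℓ' := by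
  obtain ⟨c, hc, h⟩ := h
  exact ⟨c, hc.trans hℓ, h⟩

variable [DecidableEq V]

theorem hasExactCircuit_one : HasExactCircuit enc 1 0 :=
  ⟨[], le_rfl, by simp [QuantumCircuit.toMatrix]⟩

theorem HasExactCircuit.pow {U : Matrix V V ℂ} {ℓ : ℕ} (h : HasExactCircuit enc U ℓ) (r : ℕ) :
    HasExactCircuit enc (U ^ r) (r * ℓ) := by
  induction r with
  | zero => simpa using hasExactCircuit_one
  | succ r ih => rw [pow_succ, Nat.succ_mul]; exact ih.mul h

theorem norm_ancillaIsometry_le_one (enc : V ≃ (Fin n → Bool)) (a : ℕ) :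
    ‖ancillaIsometry enc a‖ ≤ 1 := by
  have h : (ancillaIsometry enc a).conjTranspose * ancillaIsometry enc a =
      Matrix.diagonal fun _ => 1 := by
    ext v w
    rw [Matrix.mul_apply, Finset.sum_eq_single (Sum.elim (enc w) fun _ => false)]
    · simp only [ancillaIsometry, Matrix.conjTranspose_apply, Matrix.of_apply, if_true, mul_one,
        Matrix.diagonal_apply]
      by_cases hvw : v = w
      · simp [hvw]
      · rw [if_neg hvw, if_neg, star_zero]
        intro h'
        exact hvw (enc.injective (funext fun j => (congrFun h' (.inl j)).symm))
    · intro z _ hz; simp [ancillaIsometry, hz]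
    · simp
  have h2 := Matrix.l2_opNorm_conjTranspose_mul_self (ancillaIsometry enc a)
  rw [h, Matrix.l2_opNorm_diagonal] at h2
  have h3 : ‖fun _ : V => (1 : ℂ)‖ ≤ 1 := by
    rw [pi_norm_le_iff_of_nonneg (by norm_num)]; simp
  nlinarith [norm_nonneg (ancillaIsometry enc a)]

theorem HasExactCircuit.implements {U U' : Matrix V V ℂ} {ℓ : ℕ} (h : HasExactCircuit enc U ℓ)
    {ε : ℝ} (hε : ‖U - U'‖ ≤ ε) :
    ∃ c : QuantumCircuit (Fin n ⊕ Fin 1), c.Implements enc U' ε ∧ c.length ≤ ℓ := by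
  obtain ⟨c, hc, hU⟩ := h
  refine ⟨c, ?_, hc⟩
  unfold QuantumCircuit.Implements
  rw [hU, ← Matrix.mul_sub]
  refine (Matrix.l2_opNorm_mul _ _).trans (le_trans ?_ hε)
  exact mul_le_of_le_one_left (norm_nonneg _) (norm_ancillaIsometry_le_one _ _)

/-- The adjacency matrix of the single edge `e`. -/
def edgeMatrix (e : Sym2 V) : Matrix V V ℂ := Matrix.of fun x y => if s(x, y) = e then 1 else 0

/-- Only the action on basis states with ancilla 0 matters; there the map is the swap of `u` and
`v`, and zero on the other vertices. -/
theorem basisMap_mul_ancillaIsometry {u v : V} (huv : u ≠ v)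
    {f : (Fin n ⊕ Fin 1 → Bool) → Fin n ⊕ Fin 1 → Bool} {φ : (Fin n ⊕ Fin 1 → Bool) → ℂ}
    (hfu : f (Sum.elim (enc u) fun _ => false) = Sum.elim (enc v) fun _ => false)
    (hfv : f (Sum.elim (enc v) fun _ => false) = Sum.elim (enc u) fun _ => false)
    (hφ : ∀ w, φ (Sum.elim (enc w) fun _ => false) = if w = u ∨ w = v then 1 else 0) :
    basisMap f φ * ancillaIsometry enc 1 = ancillaIsometry enc 1 * edgeMatrix s(u, v) := by
  ext z w
  rw [Matrix.mul_apply, Finset.sum_eq_single (Sum.elim (enc w) fun _ => false), Matrix.mul_apply]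
  · simp only [ancillaIsometry, edgeMatrix, basisMap, Matrix.of_apply, if_true, mul_one, hφ]
    by_cases hwu : w = u
    · subst hwu
      rw [Finset.sum_eq_single v]
      · simp [hfu, Sym2.eq_swap]
      · intro x _ hx
        rw [if_neg (c := s(x, w) = s(w, v)), mul_zero]
        rw [Sym2.eq_swap, Sym2.congr_right]; exact hx
      · simp
    · by_cases hwv : w = v
      · subst hwv
        rw [Finset.sum_eq_single u]
        · simp [hfv]
        · intro x _ hx
          rw [if_neg (c := s(x, w) = s(u, w)), mul_zero]
          rw [Sym2.congr_left]; exact hx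
        · simp
      · rw [if_neg (c := w = u ∨ w = v) (by tauto), ite_self, Finset.sum_eq_zero]
        intro x _
        rw [if_neg (c := s(x, w) = s(u, v)), mul_zero]
        intro h
        rcases Sym2.eq_iff.mp h with h | h <;> tauto
  · intro y _ hy; simp [ancillaIsometry, hy]
  · simp

/-- Two-level rotations can be implemented with a number of gates linear in the number of qubits. -/
theorem hasExactCircuit_exp_edgeMatrix (enc : V ≃ (Fin n → Bool)) {u v : V} (huv : u ≠ v) (θ : ℝ) :
    HasExactCircuit enc (NormedSpace.exp ((-(θ * Complex.I)) • edgeMatrix s(u, v))) (320 * n) := by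
  obtain ⟨q, hq⟩ : ∃ q, enc u q ≠ enc v q := Function.ne_iff.mp (enc.injective.ne huv)
  have hqv : enc v q = !enc u q := by
    revert hq; cases enc u q <;> cases enc v q <;> simp
  -- The strings of `u` and `v` differ at `q`. Adding `D_j z_q` makes them agree at every other
  -- position `j`, and `K_j` turns this common bit into 1.
  let D : Fin n ⊕ Fin 1 → Bool := Sum.elim (fun j => xor (enc u j) (enc v j)) fun _ => false
  let K : Fin n ⊕ Fin 1 → Bool :=
    Sum.elim (fun j => !xor (enc u j) (xor (enc u j) (enc v j) && enc u q)) fun _ => false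
  set π := affineShear (Sum.inl q) D K (Finset.univ.erase (Sum.inl q)) with hπ
  have hππ : ∀ z, π (π z) = z := affineShear_affineShear _ _ _ _ (by simp)
  have hπc : HasClassicalCircuit π (2 * n) := by
    refine HasCircuit.mono (hasClassicalCircuit_affineShear _ D K _ (by simp)) ?_
    rw [Finset.card_erase_of_mem (Finset.mem_univ _)]
    simp
  let J : V → Fin n ⊕ Fin 1 → Bool := fun w => Sum.elim (enc w) fun _ => false
  have hπq : ∀ z, π z (.inl q) = z (.inl q) := fun z => by simp [hπ, affineShear]
  have hπr : ∀ z b, π z (.inr b) = z (.inr b) := fun z b => by simp [hπ, affineShear, D, K]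
  have hπu : ∀ j, j ≠ q → π (J u) (.inl j) = true := fun j hj => by
    simp only [hπ, affineShear, D, K, J, Finset.mem_erase, ne_eq, Sum.inl.injEq, hj,
      not_false_eq_true, Finset.mem_univ, and_self, if_true, Sum.elim_inl]
    cases enc u j <;> cases enc v j <;> cases enc u q <;> rfl
  have hπv : ∀ j, j ≠ q → π (J v) (.inl j) = true := fun j hj => by
    simp only [hπ, affineShear, D, K, J, Finset.mem_erase, ne_eq, Sum.inl.injEq, hj,
      not_false_eq_true, Finset.mem_univ, and_self, if_true, Sum.elim_inl, hqv]
    cases enc u j <;> cases enc v j <;> cases enc u q <;> rfl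
  have hones : ∀ w w' : V, (∀ j, j ≠ q → π (J w) (.inl j) = true) →
      (∀ j, j ≠ q → π (J w') (.inl j) = true) → enc w q = enc w' q → w = w' := by
    intro w w' h h' hww
    have : π (J w) = π (J w') := by
      funext x
      rcases x with j | b
      · by_cases hj : j = q
        · subst hj
          rw [hπq, hπq]; exact hww
        · rw [h j hj, h' j hj]
      · rw [hπr, hπr]; rfl
    have h2 : J w = J w' := by rw [← hππ (J w), this, hππ]
    exact enc.injective (funext fun j => congrFun h2 (.inl j))
  have hflip : ∀ w w' : V, (∀ j, j ≠ q → π (J w) (.inl j) = true) →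
      (∀ j, j ≠ q → π (J w') (.inl j) = true) → enc w' q = (!enc w q) →
      (π ∘ flipIf (.inl q) (fun _ => true) ∘ π) (J w) = J w' := by
    intro w w' h h' hww
    rw [← hππ (J w')]
    simp only [Function.comp]
    congr 1
    funext x
    rcases x with j | b
    · by_cases hj : j = q
      · subst hj
        rw [flipIf_self, hπq, hπq, Bool.xor_true]; exact hww.symm
      · rw [flipIf_of_ne _ _ (by simpa using hj), h j hj, h' j hj]
    · rw [flipIf_of_ne _ _ (by simp), hπr, hπr]; rfl
  have hind : ∀ w, allOnesOff q (π (J w)) = true ↔ w = u ∨ w = v := by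
    intro w
    rw [allOnesOff, decide_eq_true_iff]
    constructor
    · intro h
      by_cases hwq : enc w q = enc u q
      · exact Or.inl (hones _ _ h hπu hwq)
      · refine Or.inr (hones _ _ h hπv ?_)
        rw [hqv]; revert hwq; cases enc w q <;> cases enc u q <;> simp
    · rintro (rfl | rfl)
      exacts [hπu, hπv]
  set U := basisMap π 1 * hadamardOn (Sum.inl q) with hU
  set W := hadamardOn (Sum.inl q) * basisMap π 1 with hW
  have hUW : U * W = 1 := by
    rw [hU, hW, Matrix.mul_assoc, ← Matrix.mul_assoc (hadamardOn _), hadamardOn_mul_self,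
      Matrix.one_mul, basisMap_mul, ← basisMap_id_one]
    congr 1
    · funext z; exact hππ z
    · funext z; simp
  -- Eigenvalues of the edge matrix extended to the register: `±1` on the two-level space, 0
  -- elsewhere. The conjugation by `U` and `W` turns `Z` into the swap.
  set S : (Fin n ⊕ Fin 1 → Bool) → ℂ := fun z =>
    if allOnesOff q z then (if z (.inl q) then -1 else 1) else 0 with hS
  have hM : U * Matrix.diagonal S * W = basisMap (π ∘ flipIf (.inl q) (fun _ => true) ∘ π)
      (fun z => if allOnesOff q (π z) then 1 else 0) := by
    have := hadamardOn_conj_indicator (Sum.inl q) (allOnesOff q) fun y b => allOnesOff_update q y b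
    have h2 : U * Matrix.diagonal S * W = basisMap π 1 *
        (hadamardOn (Sum.inl q) * Matrix.diagonal S * hadamardOn (Sum.inl q)) * basisMap π 1 := by
      simp only [hU, hW, Matrix.mul_assoc]
    rw [h2, hS, this, basisMap_mul, basisMap_mul]
    congr 1
    funext z; simp
  have hinter : U * Matrix.diagonal S * W * ancillaIsometry enc 1 =
      ancillaIsometry enc 1 * edgeMatrix s(u, v) := by
    rw [hM]
    refine basisMap_mul_ancillaIsometry huv (hflip u v hπu hπv hqv)
      (hflip v u hπv hπu (by rw [hqv, Bool.not_not])) fun w => ?_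
    have := hind w
    simp only [J] at this
    simp only [this]
  have hexp := exp_mul_of_mul_eq (M := (-(θ * Complex.I)) • (U * Matrix.diagonal S * W))
    (E := (-(θ * Complex.I)) • edgeMatrix s(u, v)) (J := ancillaIsometry enc 1)
    (by rw [Matrix.smul_mul, hinter, Matrix.mul_smul])
  have hdiag : NormedSpace.exp ((-(θ * Complex.I)) • (U * Matrix.diagonal S * W)) =
      U * Matrix.diagonal (fun z => if allOnesOff q z then
        (if z (.inl q) then Complex.exp (θ * Complex.I) else Complex.exp (-(θ * Complex.I)))
        else 1) * W := by
    rw [← Matrix.smul_mul, ← Matrix.mul_smul, exp_conj_of_mul_eq_one hUW, ← Matrix.diagonal_smul,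
      Matrix.exp_diagonal, Pi.exp_def]
    congr 3
    funext z
    rw [← Complex.exp_eq_exp_ℂ]
    simp only [hS, Pi.smul_apply, smul_eq_mul]
    split_ifs <;> simp
  have hcirc : HasCircuit (NormedSpace.exp ((-(θ * Complex.I)) • (U * Matrix.diagonal S * W)))
      (320 * n) := by
    rw [hdiag]
    have hh := hasCircuit_hadamardOn (Sum.inl q : Fin n ⊕ Fin 1)
    have hn := q.pos
    exact (((HasCircuit.mul hπc hh).mul (hasCircuit_controlled_phase q θ)).mul
      (hh.mul hπc)).mono (by omega)
  obtain ⟨c, hc, hcM⟩ := hcirc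
  exact ⟨c, hc, by rw [hcM]; exact hexp⟩

end ExactCircuits

/-! ### Greedy edge colouring. -/

section EdgeColoring

/-- Greedy edge colouring: the edges of a graph of maximum degree `d` can be coloured with
`2 * d + 1` colours such that edges of the same colour do not meet. -/
theorem exists_edge_coloring {V : Type} [Fintype V] [DecidableEq V] (G : SimpleGraph V)
    [DecidableRel G.Adj] (d : ℕ) (hd : ∀ v, G.degree v ≤ d) :
    ∃ f : Sym2 V → Fin (2 * d + 1), ∀ e ∈ G.edgeFinset, ∀ e' ∈ G.edgeFinset, ∀ v, v ∈ e → v ∈ e' →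
      f e = f e' → e = e' := by
  suffices h : ∀ s ⊆ G.edgeFinset, ∃ f : Sym2 V → Fin (2 * d + 1), ∀ e ∈ s, ∀ e' ∈ s,
      ∀ v, v ∈ e → v ∈ e' → f e = f e' → e = e' from h _ subset_rfl
  intro s
  induction s using Finset.induction_on with
  | empty => exact fun _ => ⟨fun _ => 0, by simp⟩
  | insert e s hes ih =>
    intro hs
    obtain ⟨f, hf⟩ := ih fun x hx => hs (Finset.mem_insert_of_mem hx)
    have hsE : ∀ x ∈ s, x ∈ G.edgeSet := fun x hx =>
      SimpleGraph.mem_edgeFinset.mp (hs (Finset.mem_insert_of_mem hx))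
    obtain ⟨⟨u, v⟩⟩ := e
    change s(u, v) ∉ s at hes
    change ∃ f : Sym2 V → Fin (2 * d + 1), ∀ e ∈ insert s(u, v) s, ∀ e' ∈ insert s(u, v) s, _
    -- At most `d` edges at each endpoint block at most `2d` colours, so one of the `2d + 1` is
    -- free.
    have hcard : ((G.incidenceFinset u ∪ G.incidenceFinset v).image f).card <
        Fintype.card (Fin (2 * d + 1)) := by
      have h1 := Finset.card_union_le (G.incidenceFinset u) (G.incidenceFinset v)
      have h2 := Finset.card_image_le (s := G.incidenceFinset u ∪ G.incidenceFinset v) (f := f)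
      rw [G.card_incidenceFinset_eq_degree, G.card_incidenceFinset_eq_degree] at h1
      have h3 := hd u
      have h4 := hd v
      rw [Fintype.card_fin]; omega
    obtain ⟨c, -, hc⟩ := Finset.exists_mem_notMem_of_card_lt_card
      (hcard.trans_eq Finset.card_univ.symm)
    have hfresh : ∀ e ∈ s, ∀ w, w ∈ s(u, v) → w ∈ e → f e ≠ c := by
      rintro e he w hw hwe rfl
      refine hc (Finset.mem_image_of_mem f ?_)
      rw [Finset.mem_union, SimpleGraph.mem_incidenceFinset, SimpleGraph.mem_incidenceFinset]
      rcases Sym2.mem_iff.mp hw with rfl | rfl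
      exacts [Or.inl ⟨hsE e he, hwe⟩, Or.inr ⟨hsE e he, hwe⟩]
    have hne : ∀ e ∈ s, e ≠ s(u, v) := by rintro e he rfl; exact hes he
    refine ⟨Function.update f s(u, v) c, fun e he e' he' w hw hw' hee => ?_⟩
    rcases Finset.mem_insert.mp he with rfl | he <;> rcases Finset.mem_insert.mp he' with rfl | he'
    · rfl
    · rw [Function.update_self, Function.update_of_ne (hne _ he')] at hee
      exact absurd hee.symm (hfresh _ he' w hw hw')
    · rw [Function.update_self, Function.update_of_ne (hne _ he)] at hee
      exact absurd hee (hfresh _ he w hw' hw)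
    · rw [Function.update_of_ne (hne _ he), Function.update_of_ne (hne _ he')] at hee
      exact hf e he e' he' w hw hw' hee

end EdgeColoring

/-! ### Norms, exponentials and cost of matchings. -/

section Matchings

variable {V : Type} [DecidableEq V]

theorem sum_edgeMatrix_apply (S : Finset (Sym2 V)) (x y : V) :
    (∑ e ∈ S, edgeMatrix e) x y = if s(x, y) ∈ S then 1 else 0 := by
  rw [Matrix.sum_apply]
  simp [edgeMatrix]

theorem isHermitian_sum_edgeMatrix (S : Finset (Sym2 V)) : (∑ e ∈ S, edgeMatrix e).IsHermitian := by
  ext x y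
  rw [Matrix.conjTranspose_apply, sum_edgeMatrix_apply, sum_edgeMatrix_apply, Sym2.eq_swap]
  split_ifs <;> simp

variable [Fintype V]

theorem edgeMatrix_mul_eq_zero {e e' : Sym2 V} (h : ∀ v, v ∈ e → v ∉ e') :
    edgeMatrix e * edgeMatrix e' = 0 := by
  ext x y
  rw [Matrix.mul_apply, Matrix.zero_apply]
  refine Finset.sum_eq_zero fun z _ => ?_
  simp only [edgeMatrix, Matrix.of_apply]
  by_cases h1 : s(x, z) = e
  · rw [if_neg (c := s(z, y) = e'), mul_zero]
    rintro rfl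
    exact h z (h1 ▸ Sym2.mem_mk_right x z) (Sym2.mem_mk_left z y)
  · rw [if_neg h1, zero_mul]

/-- A walk of two steps along a matching returns to its start, so `A² = A* A` is diagonal, and its
entries are 0 or 1. -/
theorem norm_sum_edgeMatrix_le_one {S : Finset (Sym2 V)}
    (hS : ∀ e ∈ S, ∀ e' ∈ S, ∀ v, v ∈ e → v ∈ e' → e = e') : ‖∑ e ∈ S, edgeMatrix e‖ ≤ 1 := by
  set A := ∑ e ∈ S, edgeMatrix e with hA
  have hsq : A.conjTranspose * A =
      Matrix.diagonal fun x => ∑ z, if s(x, z) ∈ S then (1 : ℂ) else 0 := by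
    rw [(isHermitian_sum_edgeMatrix S).eq]
    ext x y
    rw [Matrix.mul_apply, Matrix.diagonal_apply]
    simp only [hA, sum_edgeMatrix_apply]
    by_cases hxy : x = y
    · subst hxy
      rw [if_pos rfl]
      refine Finset.sum_congr rfl fun z _ => ?_
      rw [Sym2.eq_swap (a := z)]
      split_ifs <;> simp
    · rw [if_neg hxy]
      refine Finset.sum_eq_zero fun z _ => ?_
      split_ifs with h1 h2
      · have := hS _ h1 _ h2 z (Sym2.mem_mk_right x z) (Sym2.mem_mk_left z y)
        rw [Sym2.eq_swap (a := z), Sym2.congr_left] at this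
        exact absurd this hxy
      all_goals simp
  have h2 := Matrix.l2_opNorm_conjTranspose_mul_self A
  rw [hsq, Matrix.l2_opNorm_diagonal] at h2
  have h3 : ‖fun x : V => ∑ z, if s(x, z) ∈ S then (1 : ℂ) else 0‖ ≤ 1 := by
    rw [pi_norm_le_iff_of_nonneg (by norm_num)]
    intro x
    rw [← Finset.sum_filter, Finset.sum_const, nsmul_eq_mul, mul_one, Complex.norm_natCast]
    norm_cast
    refine Finset.card_le_one.mpr fun z hz z' hz' => ?_
    simp only [Finset.mem_filter, Finset.mem_univ, true_and] at hz hz'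
    exact Sym2.congr_right.mp (hS _ hz _ hz' x (Sym2.mem_mk_left _ _) (Sym2.mem_mk_left _ _))
  nlinarith [norm_nonneg A]

theorem norm_exp_le_one_of_isHermitian [Nonempty V] {A : Matrix V V ℂ} (hA : A.IsHermitian)
    (θ : ℝ) : ‖NormedSpace.exp ((-(θ * Complex.I)) • A)‖ ≤ 1 := by
  let _ : NormedAlgebra ℚ (Matrix V V ℂ) := NormedAlgebra.restrictScalars ℚ ℂ _
  refine (CStarRing.norm_of_mem_unitary
    (NormedSpace.exp_mem_unitary_of_mem_skewAdjoint ?_)).le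
  rw [skewAdjoint.mem_iff, star_smul, Matrix.star_eq_conjTranspose, hA.eq, ← neg_smul]
  congr 1
  simp

variable {n : ℕ}

/-- Matrices of disjoint edges multiply to zero both ways, hence commute, and the exponential
factors over the edges without error. -/
theorem hasExactCircuit_exp_matching (enc : V ≃ (Fin n → Bool)) {S : Finset (Sym2 V)}
    (hS : ∀ e ∈ S, ∀ e' ∈ S, ∀ v, v ∈ e → v ∈ e' → e = e') (hdiag : ∀ e ∈ S, ¬ e.IsDiag) (θ : ℝ) :
    HasExactCircuit enc (NormedSpace.exp ((-(θ * Complex.I)) • ∑ e ∈ S, edgeMatrix e))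
      (S.card * (320 * n)) := by
  induction S using Finset.induction_on with
  | empty => simpa using hasExactCircuit_one
  | insert e s hes ih =>
    have hdisj : ∀ e' ∈ s, ∀ v, v ∈ e → v ∉ e' := fun e' he' v hv hv' => by
      have := hS e (Finset.mem_insert_self _ _) e' (Finset.mem_insert_of_mem he') v hv hv'
      exact hes (this ▸ he')
    have hcomm : Commute (edgeMatrix e) (∑ e ∈ s, edgeMatrix e) := by
      refine Commute.sum_right _ _ _ fun e' he' => ?_
      rw [Commute, SemiconjBy, edgeMatrix_mul_eq_zero (hdisj e' he'),
        edgeMatrix_mul_eq_zero fun v hv hv' => hdisj e' he' v hv' hv]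
    have he : HasExactCircuit enc (NormedSpace.exp ((-(θ * Complex.I)) • edgeMatrix e))
        (320 * n) := by
      have := hdiag e (Finset.mem_insert_self _ _)
      clear hcomm hdisj hes hS hdiag
      induction e using Sym2.ind with
      | _ u v => exact hasExactCircuit_exp_edgeMatrix enc (by simpa using this) θ
    rw [Finset.sum_insert hes, smul_add, Matrix.exp_add_of_commute _ _
      ((hcomm.smul_left _).smul_right _), Finset.card_insert_of_notMem hes]
    refine (he.mul (ih (fun e he e' he' => hS e (Finset.mem_insert_of_mem he) e'
      (Finset.mem_insert_of_mem he')) fun e he => hdiag e (Finset.mem_insert_of_mem he))).mono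
      (le_of_eq (by ring))

theorem norm_entry_le_l2_opNorm (A : Matrix V V ℂ) (i j : V) : ‖A i j‖ ≤ ‖A‖ := by
  have h := Matrix.l2_opNorm_mulVec A (EuclideanSpace.single j (1 : ℂ))
  have h1 : ‖EuclideanSpace.single j (1 : ℂ)‖ = 1 := by simp
  rw [h1, mul_one] at h
  refine le_trans ?_ h
  have h2 := PiLp.norm_apply_le (WithLp.toLp 2 (A.mulVec (EuclideanSpace.single j (1 : ℂ)))) i
  simpa using h2

theorem hasExactCircuit_expProduct {ι : Type*} {enc : V ≃ (Fin n → Bool)} (B : ι → Matrix V V ℂ)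
    (cost : ι → ℕ) (h : ∀ i (s : ℝ), HasExactCircuit enc (NormedSpace.exp ((s : ℂ) • B i)) (cost i))
    (l : List (ℝ × ι)) :
    HasExactCircuit enc (expProduct B l) (l.map fun a => cost a.2).sum := by
  induction l with
  | nil => simpa [expProduct] using hasExactCircuit_one
  | cons a l ih => simpa [expProduct] using (h a.2 a.1).mul ih

theorem sum_map_cost_suzukiFormula {ι : Type*} (js : List ι) (cost : ι → ℕ) (k : ℕ) (c : ℝ) :
    ((suzukiFormula js k c).map fun a => cost a.2).sum = 5 ^ k * (2 * (js.map cost).sum) := by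
  induction k generalizing c with
  | zero =>
    simp only [suzukiFormula, strangFormula, List.map_append, List.map_map, List.sum_append,
      List.map_reverse, List.sum_reverse, Function.comp_def]
    ring
  | succ k ih =>
    simp only [suzukiFormula, List.map_append, List.sum_append, ih]
    ring

end Matchings

/-! ### Choice of the number of steps. -/

section Arithmetic

/-- The hypothesis on `r` says `y^(2k+1) ≤ ε r^(2k)`; the factor `4^(-(2k+1)) ≤ 1/64` absorbs the 6.
-/
theorem suzuki_step_error_le {k : ℕ} (hk : 1 ≤ k) {y ε r : ℝ} (hy : 1 ≤ y) (hε : 0 < ε)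
    (hr : y ^ (1 + 1 / (2 * (k : ℝ))) / ε ^ (1 / (2 * (k : ℝ))) ≤ r) :
    r * (6 * (y / 4 / r) ^ (2 * k + 1)) ≤ ε := by
  have hk0 : (0 : ℝ) < k := by exact_mod_cast hk
  have hy0 : 0 < y := by linarith
  have hz : 0 < y ^ (1 + 1 / (2 * (k : ℝ))) / ε ^ (1 / (2 * (k : ℝ))) := by positivity
  have hr0 : 0 < r := hz.trans_le hr
  have hpow : y ^ (2 * k + 1) / ε ≤ r ^ (2 * k) := by
    refine le_trans (le_of_eq ?_) (pow_le_pow_left₀ hz.le hr (2 * k))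
    rw [div_pow, ← Real.rpow_mul_natCast hy0.le, ← Real.rpow_mul_natCast hε.le]
    congr 1
    · rw [← Real.rpow_natCast]
      congr 1; push_cast; field_simp
    · have : 1 / (2 * (k : ℝ)) * ((2 * k : ℕ) : ℝ) = 1 := by push_cast; field_simp
      rw [this, Real.rpow_one]
  have h4 : (64 : ℝ) ≤ 4 ^ (2 * k + 1) := by
    calc (64 : ℝ) = 4 ^ 3 := by norm_num
      _ ≤ 4 ^ (2 * k + 1) := pow_le_pow_right₀ (by norm_num) (by omega)
  have hyp : y ^ (2 * k + 1) ≤ ε * r ^ (2 * k) := by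
    rw [div_le_iff₀ hε] at hpow; linarith
  have e : r * (6 * (y / 4 / r) ^ (2 * k + 1)) =
      6 * y ^ (2 * k + 1) / (4 ^ (2 * k + 1) * r ^ (2 * k)) := by
    rw [div_pow, div_pow, pow_succ r]
    field_simp
  rw [e, div_le_iff₀ (by positivity)]
  have hrp : 0 < r ^ (2 * k) := by positivity
  nlinarith [mul_pos hε hrp]

theorem suzuki_step_count_le {k : ℕ} (hk : 1 ≤ k) {d h ε : ℝ} (hd : 0 ≤ d) (hh : 0 ≤ h)
    (hε : 0 < ε) :
    5 ^ (k - 1) * ((12 * d * 5 ^ (k - 1) * h) ^ (1 + 1 / (2 * (k : ℝ))) / ε ^ (1 / (2 * (k : ℝ)))) ≤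
      144 * (d ^ (1 + 1 / (2 * (k : ℝ))) * 5 ^ (2 * k) * h ^ (1 + 1 / (2 * (k : ℝ))) /
        ε ^ (1 / (2 * (k : ℝ)))) := by
  obtain ⟨j, rfl⟩ : ∃ j, k = j + 1 := ⟨k - 1, by omega⟩
  have hj : (0 : ℝ) ≤ j := by positivity
  have ha1 : 1 / (2 * ((j + 1 : ℕ) : ℝ)) ≤ 1 := by
    rw [div_le_one (by positivity)]; push_cast; linarith
  have ha2 : (j : ℝ) * (1 + 1 / (2 * ((j + 1 : ℕ) : ℝ))) ≤ j + 1 := by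
    have : (j : ℝ) * (1 / (2 * ((j + 1 : ℕ) : ℝ))) ≤ 1 := by
      rw [mul_one_div, div_le_one (by positivity)]; push_cast; linarith
    linarith
  set a := 1 / (2 * ((j + 1 : ℕ) : ℝ)) with ha
  have ha0 : 0 ≤ a := by positivity
  have h12 : (12 : ℝ) ^ (1 + a) ≤ 144 := by
    calc (12 : ℝ) ^ (1 + a) ≤ 12 ^ (2 : ℝ) :=
          Real.rpow_le_rpow_of_exponent_le (by norm_num) (by linarith)
      _ = 144 := by norm_num
  -- The exponents of 5 add up to `j + (j + 2) = 2k`.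
  have h5 : ((5 : ℝ) ^ j) ^ (1 + a) ≤ 5 ^ (j + 2) := by
    rw [← Real.rpow_natCast, ← Real.rpow_natCast, ← Real.rpow_mul (by norm_num)]
    refine Real.rpow_le_rpow_of_exponent_le (by norm_num) ?_
    push_cast; linarith
  rw [Nat.add_sub_cancel, Real.mul_rpow (by positivity) hh, Real.mul_rpow (by positivity)
    (by positivity), Real.mul_rpow (by norm_num) hd]
  calc (5 : ℝ) ^ j * (12 ^ (1 + a) * d ^ (1 + a) * (5 ^ j) ^ (1 + a) * h ^ (1 + a) / ε ^ a)
      ≤ 5 ^ j * (144 * d ^ (1 + a) * 5 ^ (j + 2) * h ^ (1 + a) / ε ^ a) := by gcongr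
    _ = _ := by ring

end Arithmetic

/-! ### Assembly of the main theorem. -/

theorem sum_colorClasses_eq_adjMatrix {V ι : Type} [Fintype V] [DecidableEq V] [Fintype ι]
    [DecidableEq ι] (G : SimpleGraph V) [DecidableRel G.Adj] (f : Sym2 V → ι) :
    ∑ i, ∑ e ∈ G.edgeFinset.filter (fun e => f e = i), edgeMatrix e = G.adjMatrix ℂ := by
  rw [Finset.sum_fiberwise]
  ext x y
  rw [sum_edgeMatrix_apply]
  simp [SimpleGraph.adjMatrix_apply]

/-- A nonzero `H` has an entry equal to `γ`, and the spectral norm dominates every entry. -/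
theorem abs_le_norm_walkHamiltonian {V : Type} [Fintype V] [DecidableEq V] (G : SimpleGraph V)
    [DecidableRel G.Adj] (γ : ℝ) (h : walkHamiltonian G γ ≠ 0) : |γ| ≤ ‖walkHamiltonian G γ‖ := by
  obtain ⟨x, y, hxy⟩ : ∃ x y, walkHamiltonian G γ x y ≠ 0 := by
    by_contra! h'
    exact h (Matrix.ext h')
  have hadj : G.Adj x y := by
    by_contra hn
    simp [walkHamiltonian, SimpleGraph.adjMatrix_apply, hn] at hxy
  have := norm_entry_le_l2_opNorm (walkHamiltonian G γ) x y
  simpa [walkHamiltonian, SimpleGraph.adjMatrix_apply, hadj] using this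

theorem theorem1 :
    ∃ C : ℝ, 0 < C ∧
      ∀ (n N d k : ℕ) (_hN : N = 2 ^ n) (_hk : 1 ≤ k)
        (G : SimpleGraph (Fin N)) [DecidableRel G.Adj] (_hd : ∀ v, G.degree v ≤ d)
        (enc : Fin N ≃ (Fin n → Bool)) (γ t ε : ℝ) (_hε : 0 < ε) (_hε1 : ε ≤ 1)
        (_hkt : 1 ≤ 12 * (d : ℝ) * 5 ^ (k - 1) * (‖walkHamiltonian G γ‖ * t)),
        ∃ (a : ℕ) (c : QuantumCircuit (Fin n ⊕ Fin a)),
          a ≤ 1 ∧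
          c.Implements enc (timeEvolution (walkHamiltonian G γ) t) ε ∧
          (c.length : ℝ) ≤
            C * ((d : ℝ) ^ (3 + 1 / (2 * (k : ℝ))) * 5 ^ (2 * k) *
              (‖walkHamiltonian G γ‖ * t) ^ (1 + 1 / (2 * (k : ℝ))) *
              N * Real.log N / ε ^ (1 / (2 * (k : ℝ)))) := by
  -- `184320 = 2 * 320 * 2 * 144`: rounding of `r`, gates per qubit in a rotation, `n ≤ 2 log N`,
  -- and `suzuki_step_count_le`.
  refine ⟨184320, by norm_num, ?_⟩
  intro n N d k hN hk G _ hd enc γ t ε hε hε1 hkt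
  have hNpos : 0 < N := by rw [hN]; positivity
  have : Nonempty (Fin N) := ⟨⟨0, hNpos⟩⟩
  set H := walkHamiltonian G γ with hH
  set h := ‖H‖ * t with hh
  have hk0 : (0 : ℝ) < k := by exact_mod_cast hk
  have hh0 : 0 < h := by
    by_contra! hn
    have : 12 * (d : ℝ) * 5 ^ (k - 1) * h ≤ 0 :=
      mul_nonpos_of_nonneg_of_nonpos (by positivity) hn
    linarith
  have hd1 : 1 ≤ d := by
    by_contra! hn
    obtain rfl : d = 0 := by omega
    norm_num at hkt
  have hd1' : (1 : ℝ) ≤ d := by exact_mod_cast hd1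
  have ht : 0 < t := pos_of_mul_pos_right hh0 (norm_nonneg _)
  have hH0 : H ≠ 0 := by
    intro h0
    rw [hh, h0, norm_zero, zero_mul] at hh0
    exact lt_irrefl _ hh0
  -- the terms of the splitting
  obtain ⟨f, hf⟩ := exists_edge_coloring G d hd
  let S : Fin (2 * d + 1) → Finset (Sym2 (Fin N)) := fun i => G.edgeFinset.filter fun e => f e = i
  have hS : ∀ i, ∀ e ∈ S i, ∀ e' ∈ S i, ∀ v, v ∈ e → v ∈ e' → e = e' := by
    intro i e he e' he' v hv hv'
    rw [Finset.mem_filter] at he he'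
    exact hf e he.1 e' he'.1 v hv hv' (he.2.trans he'.2.symm)
  have hdiag : ∀ i, ∀ e ∈ S i, ¬ e.IsDiag := fun i e he =>
    G.not_isDiag_of_mem_edgeFinset (Finset.mem_filter.mp he).1
  let B : Fin (2 * d + 1) → Matrix (Fin N) (Fin N) ℂ := fun i =>
    (-(Complex.I * (t : ℂ))) • ((γ : ℂ) • ∑ e ∈ S i, edgeMatrix e)
  let js := List.finRange (2 * d + 1)
  have hsumB : (js.map B).sum = (-(Complex.I * (t : ℂ))) • H := by
    rw [← List.ofFn_eq_map, List.sum_ofFn]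
    simp only [B, S]
    rw [← Finset.smul_sum, ← Finset.smul_sum, sum_colorClasses_eq_adjMatrix]
    rfl
  have hBθ : ∀ i (s : ℝ), (s : ℂ) • B i =
      (-((s * t * γ : ℝ) * Complex.I)) • ∑ e ∈ S i, edgeMatrix e := by
    intro i s
    simp only [B, smul_smul]
    congr 1; push_cast; ring
  have hHherm : H.IsHermitian := by
    rw [hH, walkHamiltonian, ← sum_colorClasses_eq_adjMatrix G f, Finset.sum_fiberwise]
    refine (isHermitian_sum_edgeMatrix _).smul ?_
    simp [IsSelfAdjoint]
  have hBnorm : ∀ i, ‖B i‖ ≤ h := by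
    intro i
    simp only [B, norm_smul, norm_neg, norm_mul, Complex.norm_I, Complex.norm_real, one_mul,
      Real.norm_eq_abs, abs_of_pos ht]
    calc t * (|γ| * ‖∑ e ∈ S i, edgeMatrix e‖) ≤ t * (‖H‖ * 1) := by
          gcongr
          · exact abs_le_norm_walkHamiltonian G γ hH0
          · exact norm_sum_edgeMatrix_le_one (hS i)
      _ = h := by rw [hh]; ring
  -- the number of steps
  set y := 12 * (d : ℝ) * 5 ^ (k - 1) * h with hy
  set z := y ^ (1 + 1 / (2 * (k : ℝ))) / ε ^ (1 / (2 * (k : ℝ))) with hz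
  -- As `ε ≤ 1 ≤ y`, also `1 ≤ y ≤ z`: this makes the steps short enough for the majorant bound and
  -- gives `⌈z⌉ ≤ 2z`.
  have hyz : y ≤ z := by
    rw [hz, le_div_iff₀ (by positivity)]
    calc y * ε ^ (1 / (2 * (k : ℝ))) ≤ y * 1 := by
          gcongr
          exact Real.rpow_le_one hε.le hε1 (by positivity)
      _ = y ^ (1 : ℝ) := by rw [mul_one, Real.rpow_one]
      _ ≤ _ := Real.rpow_le_rpow_of_exponent_le hkt (le_add_of_nonneg_right (by positivity))
  set r := ⌈z⌉₊ with hr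
  have hzr : z ≤ r := Nat.le_ceil _
  have hr0 : (0 : ℝ) < r := by linarith
  have hr2 : (r : ℝ) ≤ 2 * z := by
    have := Nat.ceil_lt_add_one (show 0 ≤ z by linarith)
    linarith
  -- the error
  have herr : ‖expProduct B (suzukiFormula js (k - 1) (1 / r)) ^ r -
      NormedSpace.exp (js.map B).sum‖ ≤ ε := by
    refine (norm_suzuki_pow_sub_exp_le B js (k - 1) r (by exact_mod_cast hr0) (y / 4) ?_ ?_ ?_
      ?_).trans ?_
    · have h1 : (js.map fun i => ‖B i‖).sum ≤ (2 * d + 1 : ℕ) • h := by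
        have := List.sum_le_card_nsmul (js.map fun i => ‖B i‖) h (by
          intro x hx
          obtain ⟨i, -, rfl⟩ := List.mem_map.mp hx
          exact hBnorm i)
        simpa [js] using this
      -- Since `d ≥ 1`, `2d + 1 ≤ 3d`; this is the source of `12 = 4 * 3` in `y`.
      have h2 : (2 * d + 1 : ℕ) • h ≤ 3 * d * h := by
        rw [nsmul_eq_mul]
        push_cast
        gcongr
        linarith
      calc (5 : ℝ) ^ (k - 1) * (js.map fun i => ‖B i‖).sum ≤ 5 ^ (k - 1) * (3 * d * h) := by
            gcongr
            exact h1.trans h2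
        _ = y / 4 := by rw [hy]; ring
    · rw [div_le_one hr0]; linarith
    · intro i s
      rw [hBθ]
      exact norm_exp_le_one_of_isHermitian (isHermitian_sum_edgeMatrix _) _
    · intro s
      have e : (s : ℂ) * (-(Complex.I * (t : ℂ))) = -((s * t : ℝ) * Complex.I) := by
        push_cast; ring
      rw [hsumB, smul_smul, e]
      exact norm_exp_le_one_of_isHermitian hHherm _
    · rw [show 2 * (k - 1) + 3 = 2 * k + 1 by omega]
      exact suzuki_step_error_le hk hkt hε hzr
  -- the circuit
  let cost : Fin (2 * d + 1) → ℕ := fun i => (S i).card * (320 * n)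
  have hcirc := (hasExactCircuit_expProduct (enc := enc) B cost (fun i s => by
    rw [hBθ]
    exact hasExactCircuit_exp_matching enc (hS i) (hdiag i) _)
    (suzukiFormula js (k - 1) (1 / r))).pow r
  rw [sum_map_cost_suzukiFormula] at hcirc
  rw [hsumB] at herr
  obtain ⟨c, hc, hlen⟩ := hcirc.implements herr
  refine ⟨1, c, le_rfl, hc, ?_⟩
  -- the number of gates
  have hcost : 2 * (js.map cost).sum ≤ N * d * (320 * n) := by
    have h1 : (js.map cost).sum = G.edgeFinset.card * (320 * n) := by
      rw [← List.ofFn_eq_map, List.sum_ofFn, ← Finset.sum_mul]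
      congr 1
      exact (Finset.card_eq_sum_card_fiberwise fun _ _ => Finset.mem_coe.mpr
        (Finset.mem_univ _)).symm
    -- The factor 2 of the symmetric splitting is absorbed by the handshake lemma.
    have h2 : 2 * G.edgeFinset.card ≤ N * d := by
      rw [← G.sum_degrees_eq_twice_card_edges]
      refine (Finset.sum_le_card_nsmul _ _ d fun v _ => hd v).trans (le_of_eq ?_)
      simp
    rw [h1, ← mul_assoc]
    exact Nat.mul_le_mul_right _ h2
  have hlen2 : (c.length : ℝ) ≤ r * (5 ^ (k - 1) * (N * d * (320 * n))) := by
    have : c.length ≤ r * (5 ^ (k - 1) * (N * d * (320 * n))) :=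
      hlen.trans (by gcongr)
    exact_mod_cast this
  have hlog : (n : ℝ) ≤ 2 * Real.log N := by
    rw [hN, Nat.cast_pow, Real.log_pow]
    have := Real.log_two_gt_d9
    push_cast
    nlinarith [(Nat.cast_nonneg n : (0 : ℝ) ≤ n)]
  have hlog0 : 0 ≤ Real.log N := Real.log_natCast_nonneg N
  have hsteps := suzuki_step_count_le hk (d := d) (h := h) (by positivity) hh0.le hε
  rw [← hy, ← hz] at hsteps
  set a := 1 / (2 * (k : ℝ)) with ha
  -- The count only needs `d^(2+a)`; the stated power is weaker because `d ≥ 1`.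
  have hdpow : (d : ℝ) * d ^ (1 + a) ≤ d ^ (3 + a) := by
    have : (d : ℝ) * d ^ (1 + a) = d ^ (2 + a) := by
      rw [show (2 : ℝ) + a = 1 + (1 + a) by ring, Real.rpow_add (by linarith) 1 (1 + a),
        Real.rpow_one]
    rw [this]
    exact Real.rpow_le_rpow_of_exponent_le hd1' (by linarith)
  calc (c.length : ℝ) ≤ r * (5 ^ (k - 1) * (N * d * (320 * n))) := hlen2
    _ ≤ (2 * z) * (5 ^ (k - 1) * (N * d * (320 * (2 * Real.log N)))) := by gcongr
    _ = 1280 * N * Real.log N * d * (5 ^ (k - 1) * z) := by ring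
    _ ≤ 1280 * N * Real.log N * d *
        (144 * (d ^ (1 + a) * 5 ^ (2 * k) * h ^ (1 + a) / ε ^ a)) := by gcongr
    _ = 184320 * ((d * d ^ (1 + a)) * 5 ^ (2 * k) * h ^ (1 + a) * N * Real.log N / ε ^ a) := by
        ring
    _ ≤ 184320 * (d ^ (3 + a) * 5 ^ (2 * k) * h ^ (1 + a) * N * Real.log N / ε ^ a) := by gcongr
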